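/- **Model.** An energy RAM with word size $w$ has finitely many registers of $w$ bits, a bit-addressed memory in which any contiguous segment of at most $w$ bits is accessed by one instruction, and cells that are empty or hold a $d$-bit key. Keys may only be compared, copied into empty cells, removed as known copies of another cell, moved, or overwritten. A program is a fixed finite text, independent of the number $n$ of keys, of $d$ and of $w$. Every instruction and every test takes one unit of time. The energy of a run is the number of bits that it discards: reversible instructions (in-place addition and subtraction of the value of a word operation on other registers, exchange, comparison into a register, copying into empty space, and their inverses) and branches and loops whose joins are paired with a test telling where control came from cost $0$; overwriting costs the number of bits overwritten, and in-place bitwise And/Or and every pass through an unpaired join of the control flow cost $1$. The auxiliary space of a run is measured in bits: $w$ for each register of the program, the length of the initial part of the bit memory that is accessed, and $d$ for every key cell beyond the input up to the last one accessed (so the output is included). **Theorem.** There are a program $P$, an integer $a\ge 0$ and constants $c_1,c_2,c_3>0$, and for every integer $K\ge 0$ a constant $c_4>0$, such that the following holds for all $n\ge 2$, $d\ge 1$ and $w$ with $d\le w\le K\,nd$ and $a\,nd<2^w$ (a word holds a key, is not larger than a constant multiple of the input, and can address a constant multiple of the $nd$ bits of the input); in particular $d=o(\lg n)$ is allowed.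 Let $L$ be any array of $n$ $d$-bit keys. Started with $L$ in the first $n$ key cells, with $n$ and $d$ in two registers and with everything else empty, $P$ halts in the state that differs from the initial one only in that the next $n$ key cells hold $L$ sorted in nondecreasing order (so $L$ itself is kept and all working storage is empty again). The run takes time between $c_1\,n\lg n$ and $c_2\,n\lg n$, uses auxiliary space between $c_3\,nd$ and $c_4\,nd$ bits, and consumes energy $0$. In short: comparison sort, not destroying its input, can be done reversibly on $n$ $d$-bit elements in $\Theta(n\lg n)$ time, $\Theta(nd)$ bits of auxiliary space, and $0$ energy. -/

import Mathlib

/-!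
# An energy RAM for comparison sorting

The machine has word size `w` and works on `d`-bit keys.  Its storage consists of

* finitely many registers (those that the program mentions), each holding a `w`-bit word;
* a bit-addressed memory, initially `0`, in which any contiguous segment of at most `w` bits can be
  accessed by one instruction;
* cells for keys.  A cell is empty or holds a `d`-bit key.  As in every comparison sort, keys can
  be compared, copied, and moved, but not inspected in any other way.

Programs are fixed finite texts that do not depend on the number of keys, on `d`, or on `w`.
Every instruction and every evaluation of a test takes one unit of time.  Energy is the number of
bits that are discarded: the reversible instructions (which are injective and come with their
inverse) and the paired two-way branches cost nothing, while overwriting, bitwise conjunction and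
disjunction in place, and unpaired joins of the control flow are available, but cost energy.

Instructions are partial.  Whatever they promise (an empty target of a copy, no overflow, ...) has
to hold when they are executed, otherwise the program has no run.
-/

namespace EnergyRAM

/-- Binary word operations. -/
inductive BinOp
  | left | add | sub | mul | div | mod | land | lor | lxor | shl | shr | eq | le | lt

/-- Value of a binary word operation; comparisons return `1` for true and `0` for false, and
subtraction is truncated at `0`. -/
def BinOp.eval : BinOp → ℕ → ℕ → ℕ
  | left, y, _ => y
  | add, y, z => y + z
  | sub, y, z => y - z
  | mul, y, z => y * z
  | div, y, z => y / z
  | mod, y, z => y % z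
  | land, y, z => y &&& z
  | lor, y, z => y ||| z
  | lxor, y, z => y ^^^ z
  | shl, y, z => y <<< z
  | shr, y, z => y >>> z
  | eq, y, z => if y = z then 1 else 0
  | le, y, z => if y ≤ z then 1 else 0
  | lt, y, z => if y < z then 1 else 0

/-- Instructions.  All arguments are names of registers, except for the literal constant `k` in
`addC` and `subC`. -/
inductive Instr
  /-- `x += k` -/
  | addC (x k : ℕ)
  /-- `x -= k` -/
  | subC (x k : ℕ)
  /-- `x += y op z` -/
  | add (x : ℕ) (op : BinOp) (y z : ℕ)
  /-- `x -= y op z` -/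
  | sub (x : ℕ) (op : BinOp) (y z : ℕ)
  /-- negate `x`, which has to be `0` or `1` -/
  | not (x : ℕ)
  /-- exchange two registers -/
  | swap (x y : ℕ)
  /-- `x += mem[p, p + l)` -/
  | load (x p l : ℕ)
  /-- `x -= mem[p, p + l)` -/
  | unload (x p l : ℕ)
  /-- `mem[p, p + l) += x` -/
  | store (x p l : ℕ)
  /-- `mem[p, p + l) -= x` -/
  | unstore (x p l : ℕ)
  /-- `x += (key[a] ≤ key[b])` -/
  | keyLe (x a b : ℕ)
  /-- `x -= (key[a] ≤ key[b])` -/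
  | keyUnLe (x a b : ℕ)
  /-- copy `key[a]` into the empty cell `b` -/
  | keyCopy (a b : ℕ)
  /-- empty the cell `b`, which has to hold a copy of `key[a]` -/
  | keyUnCopy (a b : ℕ)
  /-- exchange the contents of two cells -/
  | keySwap (a b : ℕ)
  /-- irreversible: `x := y` -/
  | set (x y : ℕ)
  /-- irreversible: `x := x ∧ y` bitwise -/
  | andSet (x y : ℕ)
  /-- irreversible: `x := x ∨ y` bitwise -/
  | orSet (x y : ℕ)
  /-- irreversible: `mem[p, p + l) := x` -/
  | memSet (x p l : ℕ)
  /-- irreversible: overwrite the cell `b` with `key[a]` -/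
  | keySet (a b : ℕ)

/-- Tests, evaluated on registers. -/
inductive Test
  | eqC (x k : ℕ)
  | eq (x y : ℕ)
  | le (x y : ℕ)
  | lt (x y : ℕ)
  | not (t : Test)
  | and (t u : Test)

/-- Structured programs. -/
inductive Prog
  | skip
  | instr (i : Instr)
  | seq (P Q : Prog)
  /-- Two-way branch: if `t` holds, execute `P`, otherwise `Q`.  At the join the paired test `u`
  tells where the control came from: it has to hold after `P` and to fail after `Q`. -/
  | branch (t : Test) (P Q : Prog) (u : Test)
  /-- Two-way loop: execute `P`; leave the loop if `u` holds; otherwise execute `Q` and repeat.  At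
  the head of the loop the paired test `t` tells where the control came from: it has to hold when
  the loop is entered and to fail whenever control comes back. -/
  | loop (t : Test) (P Q : Prog) (u : Test)
  /-- Conditional with an unpaired join (irreversible). -/
  | ite (t : Test) (P Q : Prog)
  /-- While loop with an unpaired join at its head (irreversible). -/
  | while (t : Test) (P : Prog)

/-- Machine states.  `key i = none` means that the cell `i` is empty. -/
@[ext]
structure State (d : ℕ) where
  reg : ℕ → ℕ
  mem : ℕ → Bool
  key : ℕ → Option (Fin (2 ^ d))

/-- Resources used by a run: number of steps, number of discarded bits, and the least upper bounds
(exclusive) for the addresses of the bits and of the key cells that were accessed. -/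
@[ext]
structure Cost where
  time : ℕ
  energy : ℕ
  bits : ℕ
  keys : ℕ

/-- Resources of two runs one after the other. -/
def Cost.seq (c c' : Cost) : Cost :=
  ⟨c.time + c'.time, c.energy + c'.energy, max c.bits c'.bits, max c.keys c'.keys⟩

/-- One evaluation of a test that discards `e` bits. -/
def Cost.test (e : ℕ) : Cost := ⟨1, e, 0, 0⟩

/-- One instruction on registers that discards `e` bits. -/
def Cost.onReg (e : ℕ) : Cost := ⟨1, e, 0, 0⟩

/-- One access to `mem[p, p + l)` that discards `e` bits. -/
def Cost.onMem (e p l : ℕ) : Cost := ⟨1, e, p + l, 0⟩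

/-- One access to the key cells `a` and `b` that discards `e` bits. -/
def Cost.onKey (e a b : ℕ) : Cost := ⟨1, e, 0, max a b + 1⟩

/-- Number represented in binary by the segment `mem[p, p + l)`. -/
def field (mem : ℕ → Bool) (p l : ℕ) : ℕ :=
  ∑ i ∈ Finset.range l, (mem (p + i)).toNat * 2 ^ i

/-- Write the number `v` in binary to the segment `mem[p, p + l)`. -/
def writeField (mem : ℕ → Bool) (p l v : ℕ) : ℕ → Bool :=
  fun j => if p ≤ j ∧ j < p + l then v.testBit (j - p) else mem j

/-- `1` if both cells hold keys and the first is at most the second one, otherwise `0`. -/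
def keyLeVal {d : ℕ} (x y : Option (Fin (2 ^ d))) : ℕ :=
  match x, y with
  | some u, some v => if u ≤ v then 1 else 0
  | _, _ => 0

namespace State

variable {d : ℕ}

def setReg (s : State d) (x v : ℕ) : State d :=
  { s with reg := Function.update s.reg x v }

def setField (s : State d) (p l v : ℕ) : State d :=
  { s with mem := writeField s.mem p l v }

def setKey (s : State d) (a : ℕ) (v : Option (Fin (2 ^ d))) : State d :=
  { s with key := Function.update s.key a v }

/-- The state in which the registers `0` and `1` hold `n` and `d`, the keys of the list `l` stand
in the first cells, and everything else is empty. -/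
def ofKeys (n d : ℕ) (l : List (Fin (2 ^ d))) : State d where
  reg := fun x => if x = 0 then n else if x = 1 then d else 0
  mem := fun _ => false
  key := fun i => l[i]?

end State

/-- Execution of one instruction with word size `w`; `none` if the instruction is undefined in the
given state. -/
def Instr.exec {d : ℕ} (w : ℕ) (i : Instr) (s : State d) : Option (State d × Cost) :=
  match i with
  | addC x k =>
      if s.reg x + k < 2 ^ w then some (s.setReg x (s.reg x + k), Cost.onReg 0) else none
  | subC x k =>
      if k ≤ s.reg x then some (s.setReg x (s.reg x - k), Cost.onReg 0) else none
  | add x op y z =>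
      let v := op.eval (s.reg y) (s.reg z)
      if x ≠ y ∧ x ≠ z ∧ s.reg x + v < 2 ^ w then
        some (s.setReg x (s.reg x + v), Cost.onReg 0) else none
  | sub x op y z =>
      let v := op.eval (s.reg y) (s.reg z)
      if x ≠ y ∧ x ≠ z ∧ v ≤ s.reg x then
        some (s.setReg x (s.reg x - v), Cost.onReg 0) else none
  | not x =>
      if s.reg x ≤ 1 then some (s.setReg x (1 - s.reg x), Cost.onReg 0) else none
  | swap x y =>
      some ((s.setReg x (s.reg y)).setReg y (s.reg x), Cost.onReg 0)
  | load x p l =>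
      let v := field s.mem (s.reg p) (s.reg l)
      if x ≠ p ∧ x ≠ l ∧ s.reg l ≤ w ∧ s.reg x + v < 2 ^ w then
        some (s.setReg x (s.reg x + v), Cost.onMem 0 (s.reg p) (s.reg l)) else none
  | unload x p l =>
      let v := field s.mem (s.reg p) (s.reg l)
      if x ≠ p ∧ x ≠ l ∧ s.reg l ≤ w ∧ v ≤ s.reg x then
        some (s.setReg x (s.reg x - v), Cost.onMem 0 (s.reg p) (s.reg l)) else none
  | store x p l =>
      let v := field s.mem (s.reg p) (s.reg l)
      if s.reg l ≤ w ∧ v + s.reg x < 2 ^ s.reg l then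
        some (s.setField (s.reg p) (s.reg l) (v + s.reg x), Cost.onMem 0 (s.reg p) (s.reg l))
      else none
  | unstore x p l =>
      let v := field s.mem (s.reg p) (s.reg l)
      if s.reg l ≤ w ∧ s.reg x ≤ v then
        some (s.setField (s.reg p) (s.reg l) (v - s.reg x), Cost.onMem 0 (s.reg p) (s.reg l))
      else none
  | keyLe x a b =>
      let v := keyLeVal (s.key (s.reg a)) (s.key (s.reg b))
      if x ≠ a ∧ x ≠ b ∧ (s.key (s.reg a)).isSome ∧ (s.key (s.reg b)).isSome ∧
          s.reg x + v < 2 ^ w then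
        some (s.setReg x (s.reg x + v), Cost.onKey 0 (s.reg a) (s.reg b)) else none
  | keyUnLe x a b =>
      let v := keyLeVal (s.key (s.reg a)) (s.key (s.reg b))
      if x ≠ a ∧ x ≠ b ∧ (s.key (s.reg a)).isSome ∧ (s.key (s.reg b)).isSome ∧
          v ≤ s.reg x then
        some (s.setReg x (s.reg x - v), Cost.onKey 0 (s.reg a) (s.reg b)) else none
  | keyCopy a b =>
      if (s.key (s.reg a)).isSome ∧ s.key (s.reg b) = none then
        some (s.setKey (s.reg b) (s.key (s.reg a)), Cost.onKey 0 (s.reg a) (s.reg b)) else none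
  | keyUnCopy a b =>
      if s.reg a ≠ s.reg b ∧ (s.key (s.reg a)).isSome ∧ s.key (s.reg b) = s.key (s.reg a) then
        some (s.setKey (s.reg b) none, Cost.onKey 0 (s.reg a) (s.reg b)) else none
  | keySwap a b =>
      some ((s.setKey (s.reg a) (s.key (s.reg b))).setKey (s.reg b) (s.key (s.reg a)),
        Cost.onKey 0 (s.reg a) (s.reg b))
  | set x y => some (s.setReg x (s.reg y), Cost.onReg w)
  | andSet x y => some (s.setReg x (s.reg x &&& s.reg y), Cost.onReg 1)
  | orSet x y => some (s.setReg x (s.reg x ||| s.reg y), Cost.onReg 1)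
  | memSet x p l =>
      if s.reg l ≤ w ∧ s.reg x < 2 ^ s.reg l then
        some (s.setField (s.reg p) (s.reg l) (s.reg x),
          Cost.onMem (s.reg l) (s.reg p) (s.reg l))
      else none
  | keySet a b =>
      some (s.setKey (s.reg b) (s.key (s.reg a)), Cost.onKey d (s.reg a) (s.reg b))

/-- Truth value of a test. -/
def Test.holds {d : ℕ} (s : State d) : Test → Prop
  | eqC x k => s.reg x = k
  | eq x y => s.reg x = s.reg y
  | le x y => s.reg x ≤ s.reg y
  | lt x y => s.reg x < s.reg y
  | not t => ¬ t.holds s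
  | and t u => t.holds s ∧ u.holds s

/-- The part of a two-way loop after its head, where `P` and `Q` are the meanings of the two parts
of the body. -/
inductive LoopRun {d : ℕ} (t : Test) (P Q : State d → State d → Cost → Prop) (u : Test) :
    State d → State d → Cost → Prop
  | exit {s s' : State d} {c : Cost} :
      P s s' c → u.holds s' → LoopRun t P Q u s s' (c.seq (Cost.test 0))
  | again {s s₁ s₂ s' : State d} {c₁ c₂ c : Cost} :
      P s s₁ c₁ → ¬ u.holds s₁ → Q s₁ s₂ c₂ → ¬ t.holds s₂ → LoopRun t P Q u s₂ s' c →
      LoopRun t P Q u s s'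
        (c₁.seq ((Cost.test 0).seq (c₂.seq ((Cost.test 0).seq c))))

/-- A while loop whose body has the meaning `P`.  Each arrival at its head discards one bit. -/
inductive WhileRun {d : ℕ} (t : Test) (P : State d → State d → Cost → Prop) :
    State d → State d → Cost → Prop
  | exit {s : State d} : ¬ t.holds s → WhileRun t P s s (Cost.test 1)
  | again {s s₁ s' : State d} {c₁ c : Cost} :
      t.holds s → P s s₁ c₁ → WhileRun t P s₁ s' c →
      WhileRun t P s s' ((Cost.test 1).seq (c₁.seq c))

/-- `P.Run w s s' c`: with word size `w`, the program `P` started in the state `s` halts in the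
state `s'` and uses the resources `c`. -/
def Prog.Run {d : ℕ} (w : ℕ) : Prog → State d → State d → Cost → Prop
  | skip, s, s', c => s' = s ∧ c = ⟨0, 0, 0, 0⟩
  | instr i, s, s', c => i.exec w s = some (s', c)
  | seq P Q, s, s', c => ∃ s₁ c₁ c₂, P.Run w s s₁ c₁ ∧ Q.Run w s₁ s' c₂ ∧ c = c₁.seq c₂
  | branch t P Q u, s, s', c =>
      (t.holds s ∧ u.holds s' ∧
        ∃ c₁, P.Run w s s' c₁ ∧ c = (Cost.test 0).seq (c₁.seq (Cost.test 0))) ∨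
      (¬ t.holds s ∧ ¬ u.holds s' ∧
        ∃ c₁, Q.Run w s s' c₁ ∧ c = (Cost.test 0).seq (c₁.seq (Cost.test 0)))
  | loop t P Q u, s, s', c =>
      t.holds s ∧ ∃ c₁, LoopRun t (P.Run w) (Q.Run w) u s s' c₁ ∧ c = (Cost.test 0).seq c₁
  | ite t P Q, s, s', c =>
      (t.holds s ∧ ∃ c₁, P.Run w s s' c₁ ∧ c = (Cost.test 1).seq c₁) ∨
      (¬ t.holds s ∧ ∃ c₁, Q.Run w s s' c₁ ∧ c = (Cost.test 1).seq c₁)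
  | Prog.while t P, s, s', c => WhileRun t (P.Run w) s s' c

/-- Registers mentioned in an instruction. -/
def Instr.regs : Instr → Finset ℕ
  | addC x _ | subC x _ | not x => {x}
  | add x _ y z | sub x _ y z => {x, y, z}
  | swap x y | set x y | andSet x y | orSet x y => {x, y}
  | load x p l | unload x p l | store x p l | unstore x p l | memSet x p l => {x, p, l}
  | keyLe x a b | keyUnLe x a b => {x, a, b}
  | keyCopy a b | keyUnCopy a b | keySwap a b | keySet a b => {a, b}

/-- Registers mentioned in a test. -/
def Test.regs : Test → Finset ℕ
  | eqC x _ => {x}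
  | eq x y | le x y | lt x y => {x, y}
  | not t => t.regs
  | and t u => t.regs ∪ u.regs

/-- Registers mentioned in a program. -/
def Prog.regs : Prog → Finset ℕ
  | skip => ∅
  | instr i => i.regs
  | seq P Q => P.regs ∪ Q.regs
  | branch t P Q u | loop t P Q u => t.regs ∪ P.regs ∪ Q.regs ∪ u.regs
  | ite t P Q => t.regs ∪ P.regs ∪ Q.regs
  | Prog.while t P => t.regs ∪ P.regs

/-- Auxiliary space in bits of a run of the program `P` with resources `c` whose input consists of
`n` keys of `d` bits in the cells `0, …, n - 1`: the bit memory, the key cells other than those of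
the input, and the registers, which have `w` bits each. -/
def auxSpace (P : Prog) (n d w : ℕ) (c : Cost) : ℕ :=
  c.bits + (c.keys - n) * d + P.regs.card * w

end EnergyRAM

/-!
The `n` keys are cut into `e = ⌊lg n⌋ + 1` blocks of at most `B = ⌊n / e⌋ + 1` keys. A block is
sorted by bottom-up merge sort in working storage, and every level of the merge sort is kept, so
that no further history is needed to undo it; as the blocks are shorter than the input by a factor
of about `lg n`, all `e + 1` levels of a block fit into `O(n)` cells. The sorted block is merged in
place, from right to left, into the output, and then the sorting of the block is undone by running
the inverse program, so that the same storage serves for the next block.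

A step of a merge can be undone because the bit that tells where the moved key came from can be
recomputed afterwards: as of two equal keys the one in the output is moved first, the key came from
the block if and only if the last key taken from the block is at most the key in the cell just
filled.

A block costs `O(e B) + O(n) = O(n)` steps, hence all blocks `O(n lg n)`.  Conversely, the `i`-th
merge into the output walks over all of the `i B` keys that the output then has, which sums to at
least `n (e + 1) / 2` steps.
-/

namespace EnergyRAM

/-! ### Costs -/

theorem Cost.seq_comm (a b : Cost) : a.seq b = b.seq a := by
  ext <;> simp [Cost.seq, Nat.add_comm, Nat.max_comm]

theorem Cost.seq_assoc (a b c : Cost) : (a.seq b).seq c = a.seq (b.seq c) := by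
  ext <;> simp [Cost.seq, Nat.add_assoc, Nat.max_assoc]

instance : Std.Commutative Cost.seq := ⟨Cost.seq_comm⟩
instance : Std.Associative Cost.seq := ⟨Cost.seq_assoc⟩

variable {d w : ℕ}

/-! ### Segments of the bit memory -/

theorem field_succ (mem : ℕ → Bool) (p l : ℕ) :
    field mem p (l + 1) = 2 ^ l * (mem (p + l)).toNat + field mem p l := by
  simp only [field, Finset.sum_range_succ]
  ring

theorem field_lt (mem : ℕ → Bool) (p l : ℕ) : field mem p l < 2 ^ l := by
  induction l with
  | zero => simp [field]
  | succ l ih =>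
    have hbit := Bool.toNat_le (mem (p + l))
    rw [field_succ, pow_succ]
    nlinarith

theorem testBit_field (mem : ℕ → Bool) (p : ℕ) {i l : ℕ} (hi : i < l) :
    (field mem p l).testBit i = mem (p + i) := by
  induction l with
  | zero => omega
  | succ l ih =>
    rw [field_succ, Nat.testBit_two_pow_mul_add _ (field_lt mem p l)]
    rcases (Nat.lt_succ_iff_lt_or_eq.mp hi) with hlt | rfl
    · rw [if_pos hlt, ih hlt]
    · cases mem (p + i) <;> simp

theorem field_writeField (mem : ℕ → Bool) (p : ℕ) {l v : ℕ} (hv : v < 2 ^ l) :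
    field (writeField mem p l v) p l = v := by
  refine Nat.eq_of_testBit_eq fun i => ?_
  rcases lt_or_ge i l with hi | hi
  · simp [testBit_field _ _ hi, writeField, hi]
  · have hpow : 2 ^ l ≤ 2 ^ i := Nat.pow_le_pow_right two_pos hi
    rw [Nat.testBit_lt_two_pow ((field_lt _ _ _).trans_le hpow),
      Nat.testBit_lt_two_pow (hv.trans_le hpow)]

theorem writeField_field (mem : ℕ → Bool) (p l : ℕ) :
    writeField mem p l (field mem p l) = mem := by
  funext j
  by_cases hj : p ≤ j ∧ j < p + l
  · rw [writeField, if_pos hj, testBit_field _ _ (by omega), Nat.add_sub_cancel' hj.1]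
  · rw [writeField, if_neg hj]

theorem writeField_writeField (mem : ℕ → Bool) (p l v v' : ℕ) :
    writeField (writeField mem p l v) p l v' = writeField mem p l v' := by
  funext j
  simp only [writeField]
  split_ifs <;> rfl

/-! ### Reversal -/

/-- The instruction that undoes a reversible instruction; irreversible instructions are left
alone. -/
def Instr.inv : Instr → Instr
  | addC x k => subC x k
  | subC x k => addC x k
  | add x op y z => sub x op y z
  | sub x op y z => add x op y z
  | load x p l => unload x p l
  | unload x p l => load x p l
  | store x p l => unstore x p l
  | unstore x p l => store x p l
  | keyLe x a b => keyUnLe x a b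
  | keyUnLe x a b => keyLe x a b
  | keyCopy a b => keyUnCopy a b
  | keyUnCopy a b => keyCopy a b
  | i => i

/-- The program that runs backwards through a reversible program: the two tests of every paired
branch and loop change places. -/
def Prog.inv : Prog → Prog
  | skip => skip
  | instr i => instr i.inv
  | seq P Q => seq Q.inv P.inv
  | branch t P Q u => branch u P.inv Q.inv t
  | loop t P Q u => loop u P.inv Q.inv t
  | P => P

/-- The instructions that discard nothing. -/
def Instr.isReversible : Instr → Bool
  | set .. | andSet .. | orSet .. | memSet .. | keySet .. => false
  | _ => true

/-- The programs all of whose instructions are reversible and all of whose joins are paired. -/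
def Prog.isReversible : Prog → Bool
  | skip => true
  | instr i => i.isReversible
  | seq P Q | branch _ P Q _ | loop _ P Q _ => P.isReversible && Q.isReversible
  | ite .. | Prog.while .. => false

/-- Contents of the registers. -/
abbrev Regs := ℕ → ℕ

/-- All registers hold words of `w` bits. -/
def Fits (w : ℕ) (r : Regs) : Prop := ∀ x, r x < 2 ^ w

theorem Fits.update {r : Regs} (hr : Fits w r) {x v : ℕ} (hv : v < 2 ^ w) :
    Fits w (Function.update r x v) := by
  intro y
  rcases eq_or_ne y x with rfl | hy
  · rwa [Function.update_self]
  · rw [Function.update_of_ne hy]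
    exact hr y

section Runs

variable {s s' : State d} {c : Cost}

theorem Instr.fits_of_exec (hw : 1 ≤ w) {i : Instr} (hs : Fits w s.reg)
    (h : i.exec w s = some (s', c)) : Fits w s'.reg := by
  have one_lt : 1 < 2 ^ w := Nat.one_lt_two_pow (by omega)
  cases i <;>
    simp only [exec, Option.ite_none_right_eq_some, Option.some.injEq, Prod.mk.injEq] at h
  case addC | add => exact h.2.1 ▸ hs.update (by omega)
  case subC x _ | sub x _ _ _  => have := hs x; exact h.2.1 ▸ hs.update (by omega)
  case not => exact h.2.1 ▸ hs.update (by omega)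
  case swap x y => exact h.1 ▸ (hs.update (hs y)).update (hs x)
  case load => exact h.2.1 ▸ hs.update h.1.2.2.2
  case unload x _ _ => have := hs x; exact h.2.1 ▸ hs.update (by omega)
  case keyLe => exact h.2.1 ▸ hs.update h.1.2.2.2.2
  case keyUnLe x _ _ => have := hs x; exact h.2.1 ▸ hs.update (by omega)
  case set x y => exact h.1 ▸ hs.update (hs y)
  case andSet x y => exact h.1 ▸ hs.update (Nat.and_lt_two_pow _ (hs y))
  case orSet x y => exact h.1 ▸ hs.update (Nat.or_lt_two_pow (hs x) (hs y))
  case store | unstore | keyCopy | keyUnCopy | memSet => exact h.2.1 ▸ hs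
  case keySwap | keySet => exact h.1 ▸ hs

theorem update_swap_swap {ι α : Type*} [DecidableEq ι] (f : ι → α) (x y : ι) :
    let g := Function.update (Function.update f x (f y)) y (f x)
    Function.update (Function.update g x (g y)) y (g x) = f := by
  funext z
  simp only [Function.update_apply]
  split_ifs <;> simp_all

theorem Instr.exec_unstore_of_store {x p l : ℕ} (h : (store x p l).exec w s = some (s', c)) :
    (unstore x p l).exec w s' = some (s, c) := by
  simp only [exec, Option.ite_none_right_eq_some, Option.some.injEq, Prod.mk.injEq] at h
  obtain ⟨⟨hl, hlt⟩, rfl, rfl⟩ := h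
  simp [exec, State.setField, field_writeField _ _ hlt, writeField_writeField, writeField_field, hl]

theorem Instr.exec_store_of_unstore {x p l : ℕ} (h : (unstore x p l).exec w s = some (s', c)) :
    (store x p l).exec w s' = some (s, c) := by
  simp only [exec, Option.ite_none_right_eq_some, Option.some.injEq, Prod.mk.injEq] at h
  obtain ⟨⟨hl, hle⟩, rfl, rfl⟩ := h
  have hlt := field_lt s.mem (s.reg p) (s.reg l)
  simp [exec, State.setField, field_writeField _ _ ((Nat.sub_le _ _).trans_lt hlt),
    writeField_writeField, writeField_field, hl, hle, hlt]

theorem Instr.exec_keyUnCopy_of_keyCopy {a b : ℕ} (h : (keyCopy a b).exec w s = some (s', c)) :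
    (keyUnCopy a b).exec w s' = some (s, c) := by
  simp only [exec, Option.ite_none_right_eq_some, Option.some.injEq, Prod.mk.injEq] at h
  obtain ⟨⟨hsome, hnone⟩, rfl, rfl⟩ := h
  have hab : s.reg a ≠ s.reg b := fun hab => by simp [hab, hnone] at hsome
  simp [exec, State.setKey, hab, hsome, ← hnone]

theorem Instr.exec_keyCopy_of_keyUnCopy {a b : ℕ} (h : (keyUnCopy a b).exec w s = some (s', c)) :
    (keyCopy a b).exec w s' = some (s, c) := by
  simp only [exec, Option.ite_none_right_eq_some, Option.some.injEq, Prod.mk.injEq] at h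
  obtain ⟨⟨hab, hsome, hcopy⟩, rfl, rfl⟩ := h
  simp only [exec, State.setKey, ne_eq, hab, not_false_eq_true, Function.update_of_ne, hsome,
    Function.update_self, and_self, if_true, Function.update_idem]
  rw [← hcopy, Function.update_eq_self]

theorem Instr.exec_inv {i : Instr} (hi : i.isReversible = true) (hs : Fits w s.reg)
    (h : i.exec w s = some (s', c)) : i.inv.exec w s' = some (s, c) := by
  cases i <;> simp only [isReversible, Bool.false_eq_true] at hi
  case store => exact exec_unstore_of_store h
  case unstore => exact exec_store_of_unstore h
  case keyCopy => exact exec_keyUnCopy_of_keyCopy h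
  case keyUnCopy => exact exec_keyCopy_of_keyUnCopy h
  all_goals
    simp only [exec, Option.ite_none_right_eq_some, Option.some.injEq, Prod.mk.injEq] at h
  case addC =>
    obtain ⟨-, rfl, rfl⟩ := h
    simp [inv, exec, State.setReg]
  case subC x k =>
    obtain ⟨hle, rfl, rfl⟩ := h
    simp [inv, exec, State.setReg, Nat.sub_add_cancel hle, hs x]
  case add | load | keyLe =>
    obtain ⟨⟨hx, hx', hcond⟩, rfl, rfl⟩ := h
    simp [inv, exec, State.setReg, hx, hx', hcond, hx.symm, hx'.symm]
  case sub x _ _ _ | unload x _ _ | keyUnLe x _ _ =>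
    obtain ⟨⟨hx, hx', hcond⟩, rfl, rfl⟩ := h
    simp [inv, exec, State.setReg, hx, hx', hcond, hx.symm, hx'.symm, Nat.sub_add_cancel, hs x]
  case not x =>
    obtain ⟨hle, rfl, rfl⟩ := h
    simp [inv, exec, State.setReg, Nat.sub_sub_self hle]
  case swap x y =>
    obtain ⟨rfl, rfl⟩ := h
    simp only [inv, exec, State.setReg, Option.some.injEq, Prod.mk.injEq, and_true]
    congr 1
    exact update_swap_swap s.reg x y
  case keySwap a b =>
    obtain ⟨rfl, rfl⟩ := h
    simp only [inv, exec, State.setKey, Option.some.injEq, Prod.mk.injEq, and_true]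
    congr 1
    exact update_swap_swap s.key (s.reg a) (s.reg b)

theorem LoopRun.fits {t u : Test} {P Q : State d → State d → Cost → Prop}
    (hP : ∀ s s' c, Fits w s.reg → P s s' c → Fits w s'.reg)
    (hQ : ∀ s s' c, Fits w s.reg → Q s s' c → Fits w s'.reg)
    (h : LoopRun t P Q u s s' c) (hs : Fits w s.reg) : Fits w s'.reg := by
  induction h with
  | exit hp _ => exact hP _ _ _ hs hp
  | again hp _ hq _ _ ih => exact ih (hQ _ _ _ (hP _ _ _ hs hp) hq)

theorem WhileRun.fits {t : Test} {P : State d → State d → Cost → Prop}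
    (hP : ∀ s s' c, Fits w s.reg → P s s' c → Fits w s'.reg)
    (h : WhileRun t P s s' c) (hs : Fits w s.reg) : Fits w s'.reg := by
  induction h with
  | exit _ => exact hs
  | again _ hp _ ih => exact ih (hP _ _ _ hs hp)

theorem Prog.Run.fits (hw : 1 ≤ w) : ∀ {P : Prog} {s s' : State d} {c : Cost},
    P.Run w s s' c → Fits w s.reg → Fits w s'.reg
  | skip, _, _, _, h, hs => h.1 ▸ hs
  | instr _, _, _, _, h, hs => Instr.fits_of_exec hw hs h
  | seq _ _, _, _, _, ⟨_, _, _, hP, hQ, _⟩, hs => hQ.fits hw (hP.fits hw hs)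
  | branch .., _, _, _, .inl ⟨_, _, _, h, _⟩, hs => h.fits hw hs
  | branch .., _, _, _, .inr ⟨_, _, _, h, _⟩, hs => h.fits hw hs
  | loop .., _, _, _, ⟨_, _, h, _⟩, hs =>
      h.fits (fun _ _ _ hs h => Prog.Run.fits hw h hs) (fun _ _ _ hs h => Prog.Run.fits hw h hs) hs
  | ite .., _, _, _, .inl ⟨_, _, h, _⟩, hs => h.fits hw hs
  | ite .., _, _, _, .inr ⟨_, _, h, _⟩, hs => h.fits hw hs
  | Prog.while .., _, _, _, h, hs =>
      WhileRun.fits (fun _ _ _ hs h => Prog.Run.fits hw h hs) h hs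

/-- What a loop still does after an execution of the first part `P` of its body, up to the state
`s'`: it leaves the loop, or it executes `Q` and returns to the head of the loop. -/
inductive LoopRest (t : Test) (P Q : State d → State d → Cost → Prop) (u : Test) :
    State d → State d → Cost → Prop
  | exit {s : State d} : u.holds s → LoopRest t P Q u s s (Cost.test 0)
  | again {s s₁ s' : State d} {c₁ c : Cost} :
      ¬ u.holds s → Q s s₁ c₁ → ¬ t.holds s₁ → LoopRun t P Q u s₁ s' c →
      LoopRest t P Q u s s' ((Cost.test 0).seq (c₁.seq ((Cost.test 0).seq c)))

theorem LoopRest.loopRun {t u : Test} {P Q : State d → State d → Cost → Prop} {s₁ : State d}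
    {c₁ : Cost} (h : LoopRest t P Q u s₁ s' c) (hP : P s s₁ c₁) :
    LoopRun t P Q u s s' (c₁.seq c) := by
  cases h with
  | exit hu => exact .exit hP hu
  | again hu hQ ht h => exact .again hP hu hQ ht h

theorem LoopRun.holds_exit {t u : Test} {P Q : State d → State d → Cost → Prop}
    (h : LoopRun t P Q u s s' c) : u.holds s' := by
  induction h with
  | exit _ hu => exact hu
  | again _ _ _ _ _ ih => exact ih

/-- As in the reversal of a list with an accumulator, `h₀` is the part of the inverse loop that has
been built from the rounds before `s`. -/
theorem LoopRun.inv_append {t u : Test} {P Q P' Q' : State d → State d → Cost → Prop}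
    {I : State d → Prop}
    (hP : ∀ s s' c, I s → P s s' c → I s' ∧ P' s' s c)
    (hQ : ∀ s s' c, I s → Q s s' c → I s' ∧ Q' s' s c)
    (h : LoopRun t P Q u s s' c) (hs : I s) {s₀ : State d} {c₀ : Cost}
    (h₀ : LoopRest u P' Q' t s s₀ c₀) :
    ∃ c', LoopRun u P' Q' t s' s₀ c' ∧ c'.seq (Cost.test 0) = c.seq c₀ := by
  induction h generalizing c₀ with
  | exit hp _ => exact ⟨_, h₀.loopRun (hP _ _ _ hs hp).2, by ac_rfl⟩
  | again hp hu hq ht _ ih =>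
    obtain ⟨hs₁, hp'⟩ := hP _ _ _ hs hp
    obtain ⟨hs₂, hq'⟩ := hQ _ _ _ hs₁ hq
    obtain ⟨c', h', hc⟩ := ih hs₂ (.again ht hq' hu (h₀.loopRun hp'))
    exact ⟨c', h', by rw [hc]; ac_rfl⟩

theorem LoopRun.inv {t u : Test} {P Q P' Q' : State d → State d → Cost → Prop}
    {I : State d → Prop}
    (hP : ∀ s s' c, I s → P s s' c → I s' ∧ P' s' s c)
    (hQ : ∀ s s' c, I s → Q s s' c → I s' ∧ Q' s' s c)
    (h : LoopRun t P Q u s s' c) (hs : I s) (ht : t.holds s) : LoopRun u P' Q' t s' s c := by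
  obtain ⟨c', h', hc⟩ := h.inv_append hP hQ hs (.exit ht)
  have hcc : c' = c := by simpa [Cost.seq, Cost.test, Cost.ext_iff] using hc
  exact hcc ▸ h'

theorem Prog.Run.inv (hw : 1 ≤ w) : ∀ {P : Prog} {s s' : State d} {c : Cost},
    P.Run w s s' c → P.isReversible = true → Fits w s.reg → P.inv.Run w s' s c
  | skip, _, _, _, ⟨hs', hc⟩, _, _ => ⟨hs'.symm, hc⟩
  | instr _, _, _, _, h, hr, hs => Instr.exec_inv hr hs h
  | seq _ _, _, _, _, ⟨s₁, c₁, c₂, hP, hQ, hc⟩, hr, hs => by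
      obtain ⟨hrP, hrQ⟩ := Bool.and_eq_true_iff.mp hr
      exact ⟨s₁, c₂, c₁, hQ.inv hw hrQ (hP.fits hw hs), hP.inv hw hrP hs,
        hc.trans (Cost.seq_comm _ _)⟩
  | branch .., _, _, _, .inl ⟨ht, hu, c₁, h, hc⟩, hr, hs =>
      .inl ⟨hu, ht, c₁, h.inv hw (Bool.and_eq_true_iff.mp hr).1 hs, hc⟩
  | branch .., _, _, _, .inr ⟨ht, hu, c₁, h, hc⟩, hr, hs =>
      .inr ⟨hu, ht, c₁, h.inv hw (Bool.and_eq_true_iff.mp hr).2 hs, hc⟩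
  | loop .., _, _, _, ⟨ht, c₁, h, hc⟩, hr, hs =>
      ⟨h.holds_exit, c₁, h.inv (I := fun s => Fits w s.reg)
        (fun _ _ _ hs h => ⟨h.fits hw hs, Prog.Run.inv hw h (Bool.and_eq_true_iff.mp hr).1 hs⟩)
        (fun _ _ _ hs h => ⟨h.fits hw hs, Prog.Run.inv hw h (Bool.and_eq_true_iff.mp hr).2 hs⟩)
        hs ht, hc⟩

/-! ### Key cells outside the accessed part -/

theorem Instr.key_eq_of_exec {i : Instr} (h : i.exec w s = some (s', c)) {a : ℕ}
    (ha : c.keys ≤ a) : s'.key a = s.key a := by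
  have update_of_lt {b : ℕ} (hb : b < a) (f : ℕ → Option (Fin (2 ^ d))) (v) :
      Function.update f b v a = f a := Function.update_of_ne hb.ne' _ _
  cases i <;>
    simp only [exec, Option.ite_none_right_eq_some, Option.some.injEq, Prod.mk.injEq] at h
  case keyCopy | keyUnCopy =>
    obtain ⟨-, rfl, rfl⟩ := h
    exact update_of_lt (by simp only [Cost.onKey] at ha; omega) _ _
  case keySwap =>
    obtain ⟨rfl, rfl⟩ := h
    simp only [Cost.onKey] at ha
    exact (update_of_lt (by omega) _ _).trans (update_of_lt (by omega) _ _)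
  case keySet =>
    obtain ⟨rfl, rfl⟩ := h
    exact update_of_lt (by simp only [Cost.onKey] at ha; omega) _ _
  case swap | set | andSet | orSet => obtain ⟨rfl, -⟩ := h; rfl
  all_goals obtain ⟨-, rfl, -⟩ := h; rfl

theorem LoopRun.key_eq {t u : Test} {P Q : State d → State d → Cost → Prop} {a : ℕ}
    (hP : ∀ s s' c, P s s' c → c.keys ≤ a → s'.key a = s.key a)
    (hQ : ∀ s s' c, Q s s' c → c.keys ≤ a → s'.key a = s.key a)
    (h : LoopRun t P Q u s s' c) (ha : c.keys ≤ a) : s'.key a = s.key a := by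
  induction h with
  | exit hp _ => exact hP _ _ _ hp (max_le_iff.mp ha).1
  | again hp _ hq _ _ ih =>
    simp only [Cost.seq, max_le_iff] at ha
    rw [ih ha.2.2.2.2, hQ _ _ _ hq ha.2.2.1, hP _ _ _ hp ha.1]

theorem WhileRun.key_eq {t : Test} {P : State d → State d → Cost → Prop} {a : ℕ}
    (hP : ∀ s s' c, P s s' c → c.keys ≤ a → s'.key a = s.key a)
    (h : WhileRun t P s s' c) (ha : c.keys ≤ a) : s'.key a = s.key a := by
  induction h with
  | exit _ => rfl
  | again _ hp _ ih =>
    simp only [Cost.seq, max_le_iff] at ha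
    rw [ih ha.2.2, hP _ _ _ hp ha.2.1]

theorem Prog.Run.key_eq : ∀ {P : Prog} {s s' : State d} {c : Cost}, P.Run w s s' c →
    ∀ {a : ℕ}, c.keys ≤ a → s'.key a = s.key a
  | skip, _, _, _, h, _, _ => by rw [h.1]
  | instr _, _, _, _, h, _, ha => Instr.key_eq_of_exec h ha
  | seq _ _, _, _, _, ⟨_, _, _, hP, hQ, hc⟩, _, ha => by
      simp only [hc, Cost.seq, max_le_iff] at ha
      rw [hQ.key_eq ha.2, hP.key_eq ha.1]
  | branch .., _, _, _, .inl ⟨_, _, _, h, hc⟩, _, ha => by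
      simp only [hc, Cost.seq, max_le_iff] at ha
      exact h.key_eq ha.2.1
  | branch .., _, _, _, .inr ⟨_, _, _, h, hc⟩, _, ha => by
      simp only [hc, Cost.seq, max_le_iff] at ha
      exact h.key_eq ha.2.1
  | loop .., _, _, _, ⟨_, _, h, hc⟩, _, ha => by
      simp only [hc, Cost.seq, max_le_iff] at ha
      exact h.key_eq (fun _ _ _ h => h.key_eq) (fun _ _ _ h => h.key_eq) ha.2
  | ite .., _, _, _, .inl ⟨_, _, h, hc⟩, _, ha => by
      simp only [hc, Cost.seq, max_le_iff] at ha
      exact h.key_eq ha.2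
  | ite .., _, _, _, .inr ⟨_, _, h, hc⟩, _, ha => by
      simp only [hc, Cost.seq, max_le_iff] at ha
      exact h.key_eq ha.2
  | Prog.while .., _, _, _, h, _, ha => WhileRun.key_eq (fun _ _ _ h => h.key_eq) h ha

end Runs

/-! ### Executions without energy on registers and keys -/

open Function (update)

/-- Contents of the key cells. -/
abbrev Keys (d : ℕ) := ℕ → Option (Fin (2 ^ d))

/-- The state with empty bit memory. -/
def State.blank (r : Regs) (k : Keys d) : State d := ⟨r, fun _ => false, k⟩

/-- The resources of a run that discards nothing, accesses neither the bit memory nor a key cell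
from `kb` on, and takes between `lo` and `hi` steps. -/
structure Cost.FreeWithin (kb lo hi : ℕ) (c : Cost) : Prop where
  energy : c.energy = 0
  bits : c.bits = 0
  keys : c.keys ≤ kb
  le_time : lo ≤ c.time
  time_le : c.time ≤ hi

variable {kb lo hi lo₁ hi₁ lo₂ hi₂ : ℕ}

namespace Cost.FreeWithin

theorem mono {c : Cost} (h : c.FreeWithin kb lo₁ hi₁) (hlo : lo ≤ lo₁) (hhi : hi₁ ≤ hi) :
    c.FreeWithin kb lo hi :=
  { h with le_time := hlo.trans h.le_time, time_le := h.time_le.trans hhi }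

theorem seq {c₁ c₂ : Cost} (h₁ : c₁.FreeWithin kb lo₁ hi₁) (h₂ : c₂.FreeWithin kb lo₂ hi₂) :
    (c₁.seq c₂).FreeWithin kb (lo₁ + lo₂) (hi₁ + hi₂) where
  energy := by simp [Cost.seq, h₁.energy, h₂.energy]
  bits := by simp [Cost.seq, h₁.bits, h₂.bits]
  keys := max_le h₁.keys h₂.keys
  le_time := add_le_add h₁.le_time h₂.le_time
  time_le := add_le_add h₁.time_le h₂.time_le

theorem zero : FreeWithin kb 0 0 ⟨0, 0, 0, 0⟩ := ⟨rfl, rfl, kb.zero_le, le_rfl, le_rfl⟩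

theorem test : (Cost.test 0).FreeWithin kb 1 1 := ⟨rfl, rfl, kb.zero_le, le_rfl, le_rfl⟩

theorem onReg : (Cost.onReg 0).FreeWithin kb 1 1 := ⟨rfl, rfl, kb.zero_le, le_rfl, le_rfl⟩

theorem onKey {a b : ℕ} (ha : a < kb) (hb : b < kb) : (Cost.onKey 0 a b).FreeWithin kb 1 1 :=
  ⟨rfl, rfl, max_lt ha hb, le_rfl, le_rfl⟩

end Cost.FreeWithin

/-- Words of `w ≥ 1` bits can address the first `kb` key cells, and the registers `r` hold such
words. -/
structure Valid (w kb : ℕ) (r : Regs) : Prop where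
  one_le : 1 ≤ w
  lt_two_pow : kb < 2 ^ w
  fits : Fits w r

/-- Provided that the registers `r` are valid, the program `P` leads from the registers `r` and the
keys `k` to `r'` and `k'`; it discards nothing, leaves the bit memory and the key cells from `kb` on
alone, and takes between `lo` and `hi` steps.  With the validity as an assumption here, the
specifications of programs only have to bound the numbers that are new in their result. -/
def Exec (w kb : ℕ) (P : Prog) (r : Regs) (k : Keys d) (r' : Regs) (k' : Keys d)
    (lo hi : ℕ) : Prop :=
  Valid w kb r → ∃ c : Cost, P.Run w (.blank r k) (.blank r' k') c ∧ c.FreeWithin kb lo hi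

variable {P Q : Prog} {r r₁ r₂ r' : Regs} {k k₁ k₂ k' : Keys d}

namespace Exec

theorem mono (h : Exec w kb P r k r' k' lo₁ hi₁) (hlo : lo ≤ lo₁ := by omega)
    (hhi : hi₁ ≤ hi := by omega) : Exec w kb P r k r' k' lo hi := fun hr =>
  let ⟨c, h, hc⟩ := h hr
  ⟨c, h, hc.mono hlo hhi⟩

theorem congr (h : Exec w kb P r k r₁ k₁ lo hi) (hr : r₁ = r') (hk : k₁ = k') :
    Exec w kb P r k r' k' lo hi := hr ▸ hk ▸ h

theorem valid (h : Exec w kb P r k r' k' lo hi) (hr : Valid w kb r) : Valid w kb r' :=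
  let ⟨_, h, _⟩ := h hr
  ⟨hr.one_le, hr.lt_two_pow, h.fits hr.one_le hr.fits⟩

theorem of_valid (h : Valid w kb r → Exec w kb P r k r' k' lo hi) :
    Exec w kb P r k r' k' lo hi := fun hr => h hr hr

theorem skip : Exec w kb .skip r k r k 0 0 := fun _ => ⟨_, ⟨rfl, rfl⟩, .zero⟩

theorem seq (hP : Exec w kb P r k r₁ k₁ lo₁ hi₁) (hQ : Exec w kb Q r₁ k₁ r' k' lo₂ hi₂) :
    Exec w kb (P.seq Q) r k r' k' (lo₁ + lo₂) (hi₁ + hi₂) := fun hr =>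
  let ⟨c₁, h₁, hc₁⟩ := hP hr
  let ⟨c₂, h₂, hc₂⟩ := hQ (hP.valid hr)
  ⟨c₁.seq c₂, ⟨_, c₁, c₂, h₁, h₂, rfl⟩, hc₁.seq hc₂⟩

theorem branch_pos {t u : Test} (ht : t.holds (.blank r k)) (hu : u.holds (.blank r' k'))
    (h : Exec w kb P r k r' k' lo hi) : Exec w kb (.branch t P Q u) r k r' k' lo (hi + 2) :=
  fun hr =>
  let ⟨c, h, hc⟩ := h hr
  ⟨_, .inl ⟨ht, hu, c, h, rfl⟩, ((Cost.FreeWithin.test.seq (hc.seq .test))).mono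
    (by omega) (by omega)⟩

theorem branch_neg {t u : Test} (ht : ¬ t.holds (.blank r k)) (hu : ¬ u.holds (.blank r' k'))
    (h : Exec w kb Q r k r' k' lo hi) : Exec w kb (.branch t P Q u) r k r' k' lo (hi + 2) :=
  fun hr =>
  let ⟨c, h, hc⟩ := h hr
  ⟨_, .inr ⟨ht, hu, c, h, rfl⟩, ((Cost.FreeWithin.test.seq (hc.seq .test))).mono
    (by omega) (by omega)⟩

theorem inv (h : Exec w kb P r k r' k' lo hi) (hP : P.isReversible = true)
    (hr : Fits w r' → Fits w r) : Exec w kb P.inv r' k' r k lo hi := fun hr' =>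
  let ⟨c, h, hc⟩ := h ⟨hr'.one_le, hr'.lt_two_pow, hr hr'.fits⟩
  ⟨c, h.inv hr'.one_le hP (hr hr'.fits), hc⟩

theorem addC {x v : ℕ} (h : r x + v < 2 ^ w) :
    Exec w kb (.instr (.addC x v)) r k (update r x (r x + v)) k 1 1 :=
  fun _ => ⟨_, if_pos h, .onReg⟩

theorem subC {x v : ℕ} (h : v ≤ r x) :
    Exec w kb (.instr (.subC x v)) r k (update r x (r x - v)) k 1 1 :=
  fun _ => ⟨_, if_pos h, .onReg⟩

theorem add {x y z : ℕ} {op : BinOp} (hy : x ≠ y) (hz : x ≠ z)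
    (h : r x + op.eval (r y) (r z) < 2 ^ w) :
    Exec w kb (.instr (.add x op y z)) r k (update r x (r x + op.eval (r y) (r z))) k 1 1 :=
  fun _ => ⟨_, if_pos ⟨hy, hz, h⟩, .onReg⟩

theorem sub {x y z : ℕ} {op : BinOp} (hy : x ≠ y) (hz : x ≠ z)
    (h : op.eval (r y) (r z) ≤ r x) :
    Exec w kb (.instr (.sub x op y z)) r k (update r x (r x - op.eval (r y) (r z))) k 1 1 :=
  fun _ => ⟨_, if_pos ⟨hy, hz, h⟩, .onReg⟩

theorem not {x : ℕ} (h : r x ≤ 1) : Exec w kb (.instr (.not x)) r k (update r x (1 - r x)) k 1 1 :=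
  fun _ => ⟨_, if_pos h, .onReg⟩

theorem keyLe {x a b : ℕ} {u v : Fin (2 ^ d)} (ha : x ≠ a) (hb : x ≠ b)
    (hu : k (r a) = some u) (hv : k (r b) = some v)
    (hx : r x + (if u ≤ v then 1 else 0) < 2 ^ w) (hak : r a < kb) (hbk : r b < kb) :
    Exec w kb (.instr (.keyLe x a b)) r k (update r x (r x + if u ≤ v then 1 else 0)) k 1 1 :=
  fun _ => ⟨_, by simp [Prog.Run, Instr.exec, State.blank, State.setReg, keyLeVal, *],
    .onKey hak hbk⟩

theorem keyUnLe {x a b : ℕ} {u v : Fin (2 ^ d)} (ha : x ≠ a) (hb : x ≠ b)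
    (hu : k (r a) = some u) (hv : k (r b) = some v) (hx : (if u ≤ v then 1 else 0) ≤ r x)
    (hak : r a < kb) (hbk : r b < kb) :
    Exec w kb (.instr (.keyUnLe x a b)) r k (update r x (r x - if u ≤ v then 1 else 0)) k 1 1 :=
  fun _ => ⟨_, by simp [Prog.Run, Instr.exec, State.blank, State.setReg, keyLeVal, *],
    .onKey hak hbk⟩

theorem keyCopy {a b : ℕ} {u : Fin (2 ^ d)} (ha : k (r a) = some u) (hb : k (r b) = none)
    (hak : r a < kb) (hbk : r b < kb) :
    Exec w kb (.instr (.keyCopy a b)) r k r (update k (r b) (some u)) 1 1 :=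
  fun _ => ⟨_, by simp [Prog.Run, Instr.exec, State.blank, State.setKey, *], .onKey hak hbk⟩

theorem keySwap {a b : ℕ} (hak : r a < kb) (hbk : r b < kb) :
    Exec w kb (.instr (.keySwap a b)) r k r
      (update (update k (r a) (k (r b))) (r b) (k (r a))) 1 1 :=
  fun _ => ⟨_, rfl, .onKey hak hbk⟩

theorem loopRun {t u : Test} {N : ℕ} {Inv : ℕ → Regs → Keys d → Prop} {lo : ℕ → ℕ}
    (ht : ∀ i r k, Inv i r k → (t.holds (.blank r k) ↔ i = 0))
    (hu : ∀ i r k, i ≤ N → Inv i r k → (u.holds (.blank r k) ↔ i = N))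
    (body : ∀ i < N, ∀ r k, Inv i r k →
      ∃ r' k', Exec w kb Q r k r' k' (lo i) hi ∧ Inv (i + 1) r' k')
    (m : ℕ) {i : ℕ} (him : i + m = N) (hInv : Inv i r k) :
    ∃ r' k', Inv N r' k' ∧ (Valid w kb r → ∃ c,
      LoopRun t (Prog.skip.Run w) (Q.Run w) u (.blank r k) (.blank r' k') c ∧
      c.FreeWithin kb (∑ j ∈ Finset.range m, (lo (i + j) + 1)) (m * (hi + 2) + 1)) := by
  induction m generalizing i r k with
  | zero =>
    obtain rfl : i = N := him
    exact ⟨r, k, hInv, fun _ => ⟨_, .exit ⟨rfl, rfl⟩ ((hu i r k le_rfl hInv).2 rfl),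
      (Cost.FreeWithin.zero.seq .test).mono (by simp) (by simp)⟩⟩
  | succ m ih =>
    obtain ⟨r₁, k₁, hQ, hInv₁⟩ := body i (by omega) r k hInv
    obtain ⟨r', k', hInv', hloop⟩ := ih (by omega) hInv₁
    have not_last : ¬ u.holds (.blank r k) := by rw [hu i r k (by omega) hInv]; omega
    have not_first : ¬ t.holds (.blank r₁ k₁) := by rw [ht _ _ _ hInv₁]; omega
    refine ⟨r', k', hInv', fun hr => ?_⟩
    obtain ⟨c, hrun, hc⟩ := hQ hr
    obtain ⟨c', hloop, hc'⟩ := hloop (hQ.valid hr)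
    refine ⟨_, .again ⟨rfl, rfl⟩ not_last hrun not_first hloop,
      (Cost.FreeWithin.zero.seq (.seq .test (hc.seq (.seq .test hc')))).mono ?_ ?_⟩
    · simp only [Finset.sum_range_succ', add_zero, add_right_comm i, ← add_assoc]
      omega
    · rw [Nat.add_mul]
      omega

theorem loop {t u : Test} (N : ℕ) (Inv : ℕ → Regs → Keys d → Prop) (lo : ℕ → ℕ)
    (ht : ∀ i r k, Inv i r k → (t.holds (.blank r k) ↔ i = 0))
    (hu : ∀ i r k, i ≤ N → Inv i r k → (u.holds (.blank r k) ↔ i = N))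
    (body : ∀ i < N, ∀ r k, Inv i r k →
      ∃ r' k', Exec w kb Q r k r' k' (lo i) hi ∧ Inv (i + 1) r' k')
    (h0 : Inv 0 r k) :
    ∃ r' k', Exec w kb (.loop t .skip Q u) r k r' k' (∑ i ∈ Finset.range N, (lo i + 1))
      (N * (hi + 2) + 2) ∧ Inv N r' k' := by
  obtain ⟨r', k', hInv, hloop⟩ := loopRun ht hu body N (zero_add N) h0
  simp only [zero_add] at hloop
  refine ⟨r', k', fun hr => ?_, hInv⟩
  obtain ⟨c, hloop, hc⟩ := hloop hr
  exact ⟨_, ⟨(ht 0 r k h0).2 rfl, c, hloop, rfl⟩,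
    (Cost.FreeWithin.test.seq hc).mono (by omega) (by omega)⟩

end Exec

/-- Execute `Q` for all values of the register `x` from `0` to that of `y`, exclusively. -/
def Prog.forLoop (x y : ℕ) (Q : Prog) : Prog :=
  .seq (.loop (.eqC x 0) .skip (Q.seq (.instr (.addC x 1))) (.eq x y)) (.instr (.sub x .left y y))

theorem Exec.forLoop {x y : ℕ} (hxy : x ≠ y) (N : ℕ) (Inv : ℕ → Regs → Keys d → Prop)
    (lo : ℕ → ℕ) (hInv : ∀ i r k, Inv i r k → r x = 0 ∧ r y = N)
    (body : ∀ i < N, ∀ r k, Inv i r k →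
      ∃ r' k', Exec w kb Q (update r x i) k (update r' x i) k' (lo i) hi ∧ Inv (i + 1) r' k')
    (h0 : Inv 0 r k) :
    ∃ r' k', Exec w kb (.forLoop x y Q) r k r' k' (∑ i ∈ Finset.range N, (lo i + 1))
      (N * (hi + 3) + 3) ∧ Inv N r' k' := by
  obtain ⟨r', k', hloop, r'', rfl, hInv'⟩ := Exec.loop (w := w) (kb := kb) (k := k)
    (Q := Q.seq (.instr (.addC x 1))) (t := .eqC x 0) (u := .eq x y) (hi := hi + 1) N
    (fun i r k => ∃ r₀, r = update r₀ x i ∧ Inv i r₀ k) lo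
    (fun i r k ⟨r₀, hr, _⟩ => by simp [Test.holds, State.blank, hr])
    (fun i r k _ ⟨r₀, hr, h⟩ => by
      simp [Test.holds, State.blank, hr, hxy.symm, (hInv _ _ _ h).2])
    (fun i hi r k ⟨r₀, hr, h⟩ => by
      obtain ⟨r', k', hQ, h'⟩ := body i hi r₀ k h
      refine ⟨update r' x (i + 1), k', .of_valid fun hvalid => ?_, r', rfl, h'⟩
      have hN : N < 2 ^ w := by simpa [hr, hxy.symm, (hInv _ _ _ h).2] using hvalid.fits y
      have haddC := (hr ▸ hQ).seq (Exec.addC (x := x) (v := 1)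
        (by simpa using (Nat.succ_le_of_lt hi).trans_lt hN))
      simpa using haddC.mono (lo := lo i))
    ⟨r, by rw [← (hInv _ _ _ h0).1, Function.update_eq_self], h0⟩
  obtain ⟨hx, hy⟩ := hInv _ _ _ hInv'
  refine ⟨r'', k', ((hloop.seq (Exec.sub hxy hxy ?_)).congr ?_ rfl).mono (by omega) le_rfl, hInv'⟩
  · simp [BinOp.eval, hxy.symm, hy]
  · simp [BinOp.eval, hxy.symm, hy, ← hx]

theorem Exec.forLoop_keys {x y : ℕ} (hxy : x ≠ y) {N : ℕ} (K : ℕ → Keys d) (lo : ℕ → ℕ)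
    (hx : r x = 0) (hy : r y = N)
    (body : ∀ i < N, Exec w kb Q (update r x i) (K i) (update r x i) (K (i + 1)) (lo i) hi) :
    Exec w kb (.forLoop x y Q) r (K 0) r (K N) (∑ i ∈ Finset.range N, (lo i + 1))
      (N * (hi + 3) + 3) := by
  obtain ⟨_, _, h, rfl, rfl⟩ := Exec.forLoop (w := w) (kb := kb) (Q := Q) (hi := hi) hxy N
    (fun i r' k' => r' = r ∧ k' = K i) lo (by rintro i r' k' ⟨rfl, -⟩; exact ⟨hx, hy⟩)
    (by rintro i hi r' k' ⟨rfl, rfl⟩; exact ⟨_, _, body i hi, rfl, rfl⟩) ⟨rfl, rfl⟩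
  exact h

/-! ### Computing and uncomputing -/

/-- Execute `Q` between `A` and the inverse of `A`. -/
def Prog.conj (A Q : Prog) : Prog := A.seq (Q.seq A.inv)

/-- Execute the instructions one after another. -/
def Prog.ofList : List Instr → Prog
  | [] => .skip
  | i :: l => .seq (.instr i) (ofList l)

/-- The list of additions and subtractions is defined on the registers `r` and leads to `r'`.
Every step records the new value, so that a derivation is a table of the computation. -/
inductive Computes (w : ℕ) : List Instr → Regs → Regs → Prop
  | nil {r : Regs} : Computes w [] r r
  | addC {x c v : ℕ} {l : List Instr} {r r' : Regs} (hv : r x + c = v) (hvw : v < 2 ^ w)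
      (h : Computes w l (update r x v) r') : Computes w (.addC x c :: l) r r'
  | subC {x c v : ℕ} {l : List Instr} {r r' : Regs} (hv : v + c = r x)
      (h : Computes w l (update r x v) r') : Computes w (.subC x c :: l) r r'
  | add {x y z v : ℕ} {op : BinOp} {l : List Instr} {r r' : Regs}
      (hv : r x + op.eval (r y) (r z) = v) (hvw : v < 2 ^ w)
      (h : Computes w l (update r x v) r') (hy : x ≠ y := by decide) (hz : x ≠ z := by decide) :
      Computes w (.add x op y z :: l) r r'
  | sub {x y z v : ℕ} {op : BinOp} {l : List Instr} {r r' : Regs}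
      (hv : v + op.eval (r y) (r z) = r x)
      (h : Computes w l (update r x v) r') (hy : x ≠ y := by decide) (hz : x ≠ z := by decide) :
      Computes w (.sub x op y z :: l) r r'

namespace Computes

variable {l : List Instr}

theorem exec (h : Computes w l r r') (k : Keys d) :
    Exec w kb (.ofList l) r k r' k 0 l.length := by
  induction h with
  | nil => exact .skip
  | addC hv hvw _ ih =>
    subst hv
    exact ((Exec.addC hvw).seq ih).mono (by omega) (by simp only [List.length_cons]; omega)
  | subC hv _ ih =>
    obtain rfl := Nat.eq_sub_of_add_eq hv
    exact ((Exec.subC (by omega)).seq ih).mono (by omega)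
      (by simp only [List.length_cons]; omega)
  | add hv hvw _ hy hz ih =>
    subst hv
    exact ((Exec.add hy hz hvw).seq ih).mono (by omega) (by simp only [List.length_cons]; omega)
  | sub hv _ hy hz ih =>
    obtain rfl := Nat.eq_sub_of_add_eq hv
    exact ((Exec.sub hy hz (by omega)).seq ih).mono (by omega)
      (by simp only [List.length_cons]; omega)

theorem isReversible (h : Computes w l r r') : (Prog.ofList l).isReversible = true := by
  induction h with
  | nil => rfl
  | addC | subC | add | sub => simp_all [Prog.ofList, Prog.isReversible, Instr.isReversible]

theorem update {y : ℕ} (h : Computes w l r r') (hy : ∀ i ∈ l, y ∉ i.regs) (v : ℕ) :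
    Computes w l (Function.update r y v) (Function.update r' y v) := by
  induction h with
  | nil => exact .nil
  | addC hv hvw _ ih =>
    simp only [List.forall_mem_cons, Instr.regs, Finset.mem_singleton] at hy
    refine .addC (by rwa [Function.update_of_ne (Ne.symm hy.1)]) hvw ?_
    exact Function.update_comm hy.1 .. ▸ ih hy.2
  | subC hv _ ih =>
    simp only [List.forall_mem_cons, Instr.regs, Finset.mem_singleton] at hy
    refine .subC (by rwa [Function.update_of_ne (Ne.symm hy.1)]) ?_
    exact Function.update_comm hy.1 .. ▸ ih hy.2
  | add hv hvw _ hxy hxz ih =>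
    simp only [List.forall_mem_cons, Instr.regs, Finset.mem_insert, Finset.mem_singleton,
      not_or] at hy
    obtain ⟨⟨hx, hy, hz⟩, hl⟩ := hy
    refine .add ?_ hvw (Function.update_comm hx .. ▸ ih hl) hxy hxz
    rwa [Function.update_of_ne (Ne.symm hx), Function.update_of_ne (Ne.symm hy),
      Function.update_of_ne (Ne.symm hz)]
  | sub hv _ hxy hxz ih =>
    simp only [List.forall_mem_cons, Instr.regs, Finset.mem_insert, Finset.mem_singleton,
      not_or] at hy
    obtain ⟨⟨hx, hy, hz⟩, hl⟩ := hy
    refine .sub ?_ (Function.update_comm hx .. ▸ ih hl) hxy hxz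
    rwa [Function.update_of_ne (Ne.symm hx), Function.update_of_ne (Ne.symm hy),
      Function.update_of_ne (Ne.symm hz)]

end Computes

namespace Exec

theorem conj {A : Prog} (hA : A.isReversible = true) (h₁ : Exec w kb A r k r₁ k₁ lo₁ hi₁)
    (h : Exec w kb Q r₁ k₁ r₂ k₂ lo hi) (h₂ : Exec w kb A r' k' r₂ k₂ lo₂ hi₂)
    (hr' : Fits w r → Fits w r₂ → Fits w r') :
    Exec w kb (A.conj Q) r k r' k' lo (hi₁ + hi + hi₂) := .of_valid fun hr =>
  (h₁.seq (h.seq (h₂.inv hA (hr' hr.fits)))).mono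

theorem conj_self {A : Prog} (hA : A.isReversible = true) (h₁ : Exec w kb A r k r₁ k₁ lo₁ hi₁)
    (h : Exec w kb Q r₁ k₁ r₁ k₂ lo hi) (h₂ : Exec w kb A r k' r₁ k₂ lo₂ hi₂) :
    Exec w kb (A.conj Q) r k r k' lo (hi₁ + hi + hi₂) :=
  h₁.conj hA h h₂ fun hr _ => hr

theorem conj_ofList {l : List Instr} (hl : Computes w l r r₁)
    (h : Exec w kb Q r₁ k r₁ k' lo hi) :
    Exec w kb (.conj (.ofList l) Q) r k r k' lo (hi + 2 * l.length) :=
  ((hl.exec k).conj_self hl.isReversible h (hl.exec k')).mono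

theorem conj_ofList_update {l : List Instr} {y v : ℕ} (hl : Computes w l r r₁)
    (hy : ∀ i ∈ l, y ∉ i.regs) (h : Exec w kb Q r₁ k (update r₁ y v) k' lo hi) :
    Exec w kb (.conj (.ofList l) Q) r k (update r y v) k' lo (hi + 2 * l.length) := by
  refine ((hl.exec k).conj hl.isReversible h ((hl.update hy v).exec k') fun hr hr₂ => ?_).mono
  simpa using hr.update (by simpa using hr₂ y)

end Exec

namespace Reg

/-- Number of keys of the input. -/
@[simp] abbrev n : ℕ := 0

/-- The constant `1`. -/
@[simp] abbrev one : ℕ := 2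

/-- Number of blocks of the input, which is also the number of merges of levels in each block. -/
@[simp] abbrev levels : ℕ := 3

/-- The power `2 ^ levels`. -/
@[simp] abbrev twoPow : ℕ := 4

/-- Length of all blocks but the last ones; also the distance of the levels. -/
@[simp] abbrev blockSize : ℕ := 5

/-- Address of the working storage. -/
@[simp] abbrev work : ℕ := 6

/-- Index of the current block. -/
@[simp] abbrev block : ℕ := 7

/-- Address of the current block. -/
@[simp] abbrev blockStart : ℕ := 8

/-- Number of keys of the input from the current block on. -/
@[simp] abbrev blockRest : ℕ := 9

/-- Number of keys that the current block lacks to the full length. -/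
@[simp] abbrev blockExcess : ℕ := 10

/-- Length of the current block. -/
@[simp] abbrev blockLen : ℕ := 11

/-- Index of the level that is read. -/
@[simp] abbrev level : ℕ := 12

/-- Address of the level that is read. -/
@[simp] abbrev levelStart : ℕ := 13

/-- Address of the level that is written. -/
@[simp] abbrev nextStart : ℕ := 14

/-- Length of the runs of the level that is read. -/
@[simp] abbrev runLen : ℕ := 15

/-- Index of the last key of the current block. -/
@[simp] abbrev lastIdx : ℕ := 16

/-- Number of runs of the level that is read. -/
@[simp] abbrev runs : ℕ := 17

/-- Index of the current run; also the loop counter when a block is copied. -/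
@[simp] abbrev run : ℕ := 18

/-- Offset of the current run in its level. -/
@[simp] abbrev runOffset : ℕ := 19

/-- Number of keys of the level from the current run on. -/
@[simp] abbrev runRest : ℕ := 20

/-- Number of keys that the current run lacks to the full length. -/
@[simp] abbrev runExcess : ℕ := 21

/-- Parity of the index of the current run. -/
@[simp] abbrev parity : ℕ := 22

/-- Number of keys that the target of a merge holds before. -/
@[simp] abbrev dstLen : ℕ := 23

/-- Length of the source of a merge. -/
@[simp] abbrev srcLen : ℕ := 24

/-- Address of the source of a merge or of a copy. -/
@[simp] abbrev src : ℕ := 25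

/-- Address of the target of a merge or of a copy. -/
@[simp] abbrev dst : ℕ := 26

/-- Length of the result of a merge. -/
@[simp] abbrev total : ℕ := 27

/-- Number of keys that a merge has already put to their place. -/
@[simp] abbrev step : ℕ := 28

/-- Number of keys of the source that are still to be merged. -/
@[simp] abbrev rem : ℕ := 29

/-- Index, within the result of a merge, of the next cell to be filled. -/
@[simp] abbrev idx : ℕ := 30

/-- `1` if the next cell receives a key of the source, otherwise `0`. -/
@[simp] abbrev flag : ℕ := 31

/-- Address of a key to be read from the target of a merge. -/
@[simp] abbrev dstKey : ℕ := 32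

/-- Address of a key to be read from the source of a merge. -/
@[simp] abbrev srcKey : ℕ := 33

/-- Address of the next cell to be filled. -/
@[simp] abbrev cell : ℕ := 34

/-- Number of cells by which the current block starts after the end of the input. -/
@[simp] abbrev outExcess : ℕ := 35

end Reg

/-! ### Merging -/

/-- Set the flag that tells whether the next key comes from the source. -/
def mergeDecide : Prog :=
  .branch (.and (.le Reg.one Reg.rem) (.le Reg.rem Reg.idx))
    (.conj
      (.ofList [.add Reg.dstKey .sub Reg.cell Reg.rem, .add Reg.srcKey .add Reg.src Reg.rem,
        .subC Reg.srcKey 1])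
      (.seq (.instr (.keyLe Reg.flag Reg.srcKey Reg.dstKey)) (.instr (.not Reg.flag))))
    (.instr (.add Reg.flag .le Reg.one Reg.rem))
    (.and (.le Reg.one Reg.rem) (.le Reg.rem Reg.idx))

/-- Move the key chosen by the flag into the next cell. -/
def mergeMove : Prog :=
  .branch (.eqC Reg.flag 1)
    (.seq (.instr (.subC Reg.rem 1)) <|
      .conj (.ofList [.add Reg.srcKey .add Reg.src Reg.rem])
        (.instr (.keyCopy Reg.srcKey Reg.cell)))
    (.conj (.ofList [.add Reg.dstKey .sub Reg.cell Reg.rem])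
      (.instr (.keySwap Reg.dstKey Reg.cell)))
    (.eqC Reg.flag 1)

/-- Clear the flag: the key that was just moved came from the source if and only if it is at least
the last key taken from the source. -/
def mergeUndecide : Prog :=
  .branch (.lt Reg.rem Reg.srcLen)
    (.conj (.ofList [.add Reg.srcKey .add Reg.src Reg.rem])
      (.instr (.keyUnLe Reg.flag Reg.srcKey Reg.cell)))
    .skip
    (.lt Reg.rem Reg.srcLen)

/-- Compute the index and the address of the next cell. -/
def mergeCell : List Instr :=
  [.add Reg.idx .sub Reg.total Reg.step, .subC Reg.idx 1, .add Reg.cell .add Reg.dst Reg.idx]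

/-- Fill the next cell of the result of a merge. -/
def mergeStep : Prog := .conj (.ofList mergeCell) (mergeDecide.seq (mergeMove.seq mergeUndecide))

/-- The registers inside `mergeStep`, apart from the flag. -/
structure MergeStepRegs (r : Regs) (src srcLen rem idx cell : ℕ) : Prop where
  one : r Reg.one = 1
  srcLen : r Reg.srcLen = srcLen
  src : r Reg.src = src
  rem : r Reg.rem = rem
  idx : r Reg.idx = idx
  dstKey : r Reg.dstKey = 0
  srcKey : r Reg.srcKey = 0
  cell : r Reg.cell = cell

section MergeStep

variable {src dst lb tot x b p c : ℕ} {u v : Fin (2 ^ d)}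

namespace MergeStepRegs

theorem update_flag (h : MergeStepRegs r src lb b p c) (f : ℕ) :
    MergeStepRegs (update r Reg.flag f) src lb b p c := by
  cases h
  constructor <;> simp [*]

theorem update_rem (h : MergeStepRegs r src lb b p c) (b' : ℕ) :
    MergeStepRegs (update r Reg.rem b') src lb b' p c := by
  cases h
  constructor <;> simp [*]

theorem decide_keys (h : MergeStepRegs r src lb (b + 1) p c) (hflag : r Reg.flag = 0)
    (hbp : b < p) (hu : k (src + b) = some u) (hv : k (c - (b + 1)) = some v)
    (hs : src + b < kb) (hc : c < kb) :
    Exec w kb mergeDecide r k (update r Reg.flag (if u ≤ v then 0 else 1)) k 0 10 := by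
  obtain ⟨h_one, -, h_src, h_rem, h_idx, h_dstKey, h_srcKey, h_cell⟩ := h
  refine .of_valid fun ⟨_, hkb, _⟩ => .branch_pos (hi := 8) ?_ ?_ ?_
  · simp [Test.holds, State.blank, h_one, h_rem, h_idx, hbp]
  · simp [Test.holds, State.blank, h_one, h_rem, h_idx, hbp]
  refine (Exec.conj_ofList_update (lo := 2) (hi := 2)
    (.add (v := c - (b + 1)) ?_ (by omega) <| .add (v := src + b + 1) ?_ (by omega) <|
      .subC (v := src + b) ?_ .nil)
    (by simp [Instr.regs]) ?_).mono (by omega) le_rfl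
  · simp [BinOp.eval, h_dstKey, h_cell, h_rem]
  · simp [BinOp.eval, h_srcKey, h_src, h_rem, add_assoc]
  · simp
  refine ((Exec.keyLe (u := u) (v := v) (by decide) (by decide) ?_ ?_ ?_ ?_ ?_).seq
    (Exec.not ?_)).congr ?_ rfl
  · simpa
  · simpa
  · suffices (if u ≤ v then 1 else 0) < 2 ^ w by simpa [hflag] using this
    split_ifs <;> omega
  · simpa
  · simpa using (Nat.sub_le c (b + 1)).trans_lt hc
  · by_cases huv : u ≤ v <;> simp [hflag, huv]
  · by_cases huv : u ≤ v <;> simp [hflag, huv]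

theorem decide_exhausted (h : MergeStepRegs r src lb b p c) (hflag : r Reg.flag = 0)
    (hbp : b = 0 ∨ p < b) :
    Exec w kb mergeDecide r k (update r Reg.flag (if 1 ≤ b then 1 else 0)) k 0 10 := by
  refine .of_valid fun ⟨hw, _, _⟩ => (Exec.branch_neg (lo := 1) (hi := 1) ?_ ?_
    ((Exec.add (by decide) (by decide) ?_).congr ?_ rfl)).mono
  · simpa [Test.holds, State.blank, h.one, h.rem, h.idx] using fun hb : 1 ≤ b => by omega
  · simpa [Test.holds, State.blank, h.one, h.rem, h.idx] using fun hb : 1 ≤ b => by omega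
  · have one_lt : 1 < 2 ^ w := Nat.one_lt_two_pow (by omega)
    by_cases hb : 1 ≤ b <;> simp [BinOp.eval, h.one, h.rem, hflag, hb, one_lt]
  · simp [BinOp.eval, h.one, h.rem, hflag]

theorem move_source (h : MergeStepRegs r src lb (b + 1) p c) (hflag : r Reg.flag = 1)
    (hu : k (src + b) = some u) (hk : k c = none) (hs : src + b < kb) (hc : c < kb) :
    Exec w kb mergeMove r k (update r Reg.rem b) (update k c (some u)) 0 6 := by
  refine .of_valid fun ⟨_, hkb, _⟩ => .branch_pos (hi := 4) ?_ ?_ ?_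
  · simp [Test.holds, State.blank, hflag]
  · simp [Test.holds, State.blank, hflag]
  have h_dec : Exec w kb (.instr (.subC Reg.rem 1)) r k (update r Reg.rem b) k 1 1 :=
    (Exec.subC (by simp [h.rem])).congr (by simp [h.rem]) rfl
  refine (h_dec.seq (.conj_ofList (lo := 1) (hi := 1)
    (.add (v := src + b) (by simp [BinOp.eval, h.srcKey, h.src]) (by omega) .nil)
    ((Exec.keyCopy (u := u) ?_ ?_ ?_ ?_).congr rfl ?_))).mono (by omega) le_rfl <;> simp [h.cell, *]

theorem move_target (h : MergeStepRegs r src lb b p c) (hflag : r Reg.flag = 0)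
    (hv : k (c - b) = some v) (hc : c < kb) :
    Exec w kb mergeMove r k r (update (update k (c - b) (k c)) c (some v)) 0 6 := by
  refine .of_valid fun ⟨_, hkb, _⟩ => (Exec.branch_neg (lo := 1) (hi := 3) ?_ ?_ ?_).mono
  · simp [Test.holds, State.blank, hflag]
  · simp [Test.holds, State.blank, hflag]
  refine .conj_ofList (lo := 1) (hi := 1)
    (.add (v := c - b) (by simp [BinOp.eval, h.dstKey, h.cell, h.rem]) (by omega) .nil)
    ((Exec.keySwap ?_ ?_).congr rfl (by simp [h.cell, hv])) <;> simp [h.cell] <;> omega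

theorem undecide_keys (h : MergeStepRegs r src lb b p c) (hb : b < lb)
    (hu : k (src + b) = some u) (hv : k c = some v) (hflag : r Reg.flag = if u ≤ v then 1 else 0)
    (hs : src + b < kb) (hc : c < kb) :
    Exec w kb mergeUndecide r k (update r Reg.flag 0) k 0 5 := by
  refine .of_valid fun ⟨_, hkb, _⟩ => (Exec.branch_pos (lo := 1) (hi := 3) ?_ ?_ ?_).mono
  · simp [Test.holds, State.blank, h.rem, h.srcLen, hb]
  · simp [Test.holds, State.blank, h.rem, h.srcLen, hb]
  refine .conj_ofList_update (lo := 1) (hi := 1)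
    (.add (v := src + b) (by simp [BinOp.eval, h.srcKey, h.src, h.rem]) (by omega) .nil)
    (by simp [Instr.regs])
    ((Exec.keyUnLe (u := u) (v := v) (by decide) (by decide) ?_ ?_ ?_ ?_ ?_).congr ?_ rfl) <;>
    simp [h.cell, *]

theorem undecide_skip (h : MergeStepRegs r src lb b p c) (hb : lb ≤ b) :
    Exec w kb mergeUndecide r k r k 0 5 :=
  (Exec.branch_neg (by simp [Test.holds, State.blank, h.rem, h.srcLen, hb])
    (by simp [Test.holds, State.blank, h.rem, h.srcLen, hb]) .skip).mono

end MergeStepRegs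

/-- The registers of `mergeStep`. -/
structure MergeRegs (r : Regs) (src dst srcLen total step rem : ℕ) : Prop where
  one : r Reg.one = 1
  srcLen : r Reg.srcLen = srcLen
  src : r Reg.src = src
  dst : r Reg.dst = dst
  total : r Reg.total = total
  step : r Reg.step = step
  rem : r Reg.rem = rem
  idx : r Reg.idx = 0
  flag : r Reg.flag = 0
  dstKey : r Reg.dstKey = 0
  srcKey : r Reg.srcKey = 0
  cell : r Reg.cell = 0

namespace MergeRegs

theorem computes_cell (h : MergeRegs r src dst lb (x + p + 1) x b) (hw : dst + p + 1 < 2 ^ w) :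
    Computes w mergeCell r (update (update r Reg.idx p) Reg.cell (dst + p)) := by
  have h_comp : Computes w mergeCell r _ :=
    .add (v := p + 1) (by simp [BinOp.eval, h.idx, h.total, h.step, add_assoc]) (by omega) <|
      .subC (v := p) (by simp) <|
      .add (v := dst + p) (by simp [BinOp.eval, h.cell, h.dst]) (by omega) .nil
  simpa using h_comp

theorem stepRegs (h : MergeRegs r src dst lb tot x b) (p c : ℕ) :
    MergeStepRegs (update (update r Reg.idx p) Reg.cell c) src lb b p c := by
  cases h
  constructor <;> simp [*]

theorem step_source (h : MergeRegs r src dst lb (x + p + 1) x (b + 1)) (hlb : b < lb)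
    (hu : k (src + b) = some u) (hk : k (dst + p) = none)
    (hv : b < p → ∃ v, k (dst + p - (b + 1)) = some v ∧ v < u)
    (hs : src + b < kb) (hd : dst + p < kb) :
    Exec w kb mergeStep r k (update r Reg.rem b) (update k (dst + p) (some u)) 0 27 := by
  refine .of_valid fun ⟨_, hkb, _⟩ => .conj_ofList_update (lo := 0) (hi := 21)
    (h.computes_cell (by omega)) (by simp [mergeCell, Instr.regs]) ?_
  have h₁ := h.stepRegs p (dst + p)
  have hflag : update (update r Reg.idx p) Reg.cell (dst + p) Reg.flag = 0 := by simp [h.flag]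
  set r₁ := update (update r Reg.idx p) Reg.cell (dst + p)
  have h_decide : Exec w kb mergeDecide r₁ k (update r₁ Reg.flag 1) k 0 10 := by
    by_cases hbp : b < p
    · obtain ⟨v, hv, hvu⟩ := hv hbp
      simpa [hvu.not_ge] using h₁.decide_keys hflag hbp hu hv hs hd
    · simpa using h₁.decide_exhausted hflag (.inr (by omega))
  have h_move := (h₁.update_flag 1).move_source (w := w) (by simp) hu hk hs hd
  have hne : src + b ≠ dst + p := fun e => by simp [← e, hu] at hk
  have h_undecide := ((h₁.update_flag 1).update_rem b).undecide_keys (w := w) (kb := kb)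
    (k := update k (dst + p) (some u)) (u := u) (v := u) hlb (by simpa [hne]) (by simp) (by simp)
    hs hd
  refine (h_decide.seq (h_move.seq h_undecide)).congr ?_ rfl
  rw [Function.update_comm (by decide), Function.update_idem, ← hflag, Function.update_eq_self]

theorem step_target (h : MergeRegs r src dst lb (x + p + 1) x b) (hlb : b ≤ lb) (hbp : b ≤ p)
    (hv : k (dst + p - b) = some v) (hu : ∀ b', b = b' + 1 → ∃ u, k (src + b') = some u ∧ u ≤ v)
    (hu' : b < lb → ∃ u, k (src + b) = some u ∧ v < u)
    (hne : b < lb → src + b ≠ dst + p ∧ src + b ≠ dst + p - b)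
    (hs : src + lb ≤ kb) (hd : dst + p < kb) :
    Exec w kb mergeStep r k r
      (update (update k (dst + p - b) (k (dst + p))) (dst + p) (some v)) 0 27 := by
  refine .of_valid fun ⟨_, hkb, _⟩ => .conj_ofList (lo := 0) (hi := 21)
    (h.computes_cell (by omega)) ?_
  have h₁ := h.stepRegs p (dst + p)
  have hflag : update (update r Reg.idx p) Reg.cell (dst + p) Reg.flag = 0 := by simp [h.flag]
  set r₁ := update (update r Reg.idx p) Reg.cell (dst + p)
  have update_flag : update r₁ Reg.flag 0 = r₁ := by rw [← hflag, Function.update_eq_self]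
  have h_decide : Exec w kb mergeDecide r₁ k r₁ k 0 10 := by
    rcases b with - | b
    · simpa [update_flag] using h₁.decide_exhausted (w := w) (kb := kb) (k := k) hflag (.inl rfl)
    · obtain ⟨u, hu, huv⟩ := hu b rfl
      simpa [huv, update_flag] using h₁.decide_keys (w := w) hflag hbp hu hv (by omega) hd
  refine h_decide.seq ((h₁.move_target hflag hv hd).seq (hi₂ := 5) (lo₂ := 0) ?_)
  by_cases hb : b < lb
  · obtain ⟨u, hu, hvu⟩ := hu' hb
    have h_undecide := h₁.undecide_keys (w := w) (kb := kb)
      (k := update (update k (dst + p - b) (k (dst + p))) (dst + p) (some v)) hb (u := u) (v := v)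
      (by simpa [hne hb]) (by simp) (by simp [hflag, hvu.not_ge]) (by omega) hd
    rwa [update_flag] at h_undecide
  · exact h₁.undecide_skip (by omega)

end MergeRegs

end MergeStep

section MergeState

variable {α : Type*} {M T S : List α} {a b : ℕ} {u v x y : α}

theorem take_succ_eq_append {l : List α} (hx : l[a]? = some x) :
    l.take (a + 1) = l.take a ++ [x] := by
  rw [List.take_add_one, hx, Option.toList_some]

section Preorder

variable [Preorder α]

theorem le_of_mem_take_succ {l : List α} (hl : l.Pairwise (· ≤ ·)) (hx : l[a]? = some x)
    (hy : y ∈ l.take (a + 1)) : y ≤ x := by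
  obtain ⟨h, rfl⟩ := List.getElem?_eq_some_iff.1 hx
  obtain ⟨i, hi, rfl⟩ := List.mem_take_iff_getElem.1 hy
  exact hl.rel_get_of_le (a := ⟨i, by omega⟩) (b := ⟨a, h⟩) (Fin.mk_le_mk.2 (by omega))

/-- Merging the sorted lists `M` and `T` from the right has reached the state in which the first `a`
elements of `M` and the first `b` elements of `T` are left, and the others form the list `S`.  Among
equal elements, those of `T` come last in the result. -/
structure MergeState (M T : List α) (a b : ℕ) (S : List α) : Prop where
  le_left : a ≤ M.length
  le_right : b ≤ T.length
  pairwise : S.Pairwise (· ≤ ·)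
  add_eq : (M.take a + T.take b + S : Multiset α) = M + T
  left_le : ∀ x ∈ M.take a, ∀ s ∈ S, x ≤ s
  right_le : ∀ x ∈ T.take b, ∀ s ∈ S, x ≤ s
  left_lt : ∀ x ∈ M.take a, ∀ u, T[b]? = some u → x < u

namespace MergeState

theorem init (M T : List α) : MergeState M T M.length T.length [] := by
  constructor <;> simp

theorem length (h : MergeState M T a b S) : a + b + S.length = M.length + T.length := by
  simpa [h.le_left, h.le_right, add_assoc] using congrArg Multiset.card h.add_eq

theorem cons_right (h : MergeState M T a (b + 1) S) (hT : T.Pairwise (· ≤ ·))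
    (hu : T[b]? = some u) (hlt : ∀ x ∈ M.take a, x < u) : MergeState M T a b (u :: S) where
  le_left := h.le_left
  le_right := b.le_succ.trans h.le_right
  pairwise := h.pairwise.cons (h.right_le u (by simp [take_succ_eq_append hu]))
  add_eq := by
    rw [← h.add_eq, take_succ_eq_append hu]
    simp
  left_le x hx := List.forall_mem_cons.2 ⟨(hlt x hx).le, h.left_le x hx⟩
  right_le x hx := by
    have hx' : x ∈ T.take (b + 1) := List.take_subset_take_left T b.le_succ hx
    exact List.forall_mem_cons.2 ⟨le_of_mem_take_succ hT hu hx', h.right_le x hx'⟩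
  left_lt x hx u' hu' := by
    cases hu.symm.trans hu'
    exact hlt x hx

theorem cons_left (h : MergeState M T (a + 1) b S) (hM : M.Pairwise (· ≤ ·))
    (hv : M[a]? = some v) (hle : ∀ x ∈ T.take b, x ≤ v) : MergeState M T a b (v :: S) where
  le_left := a.le_succ.trans h.le_left
  le_right := h.le_right
  pairwise := h.pairwise.cons (h.left_le v (by simp [take_succ_eq_append hv]))
  add_eq := by
    rw [← h.add_eq, take_succ_eq_append hv]
    simpa using List.perm_middle.append_left (M.take a)
  left_le x hx := by
    have hx' : x ∈ M.take (a + 1) := List.take_subset_take_left M a.le_succ hx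
    exact List.forall_mem_cons.2 ⟨le_of_mem_take_succ hM hv hx', h.left_le x hx'⟩
  right_le x hx := List.forall_mem_cons.2 ⟨hle x hx, h.right_le x hx⟩
  left_lt x hx := h.left_lt x (List.take_subset_take_left M a.le_succ hx)

end MergeState

end Preorder

namespace MergeState

variable [LinearOrder α]

theorem eq_sort (h : MergeState M T 0 0 S) : S = (M + T : Multiset α).sort := by
  refine List.Perm.eq_of_pairwise' h.pairwise (Multiset.pairwise_sort ..) ?_
  rw [← Multiset.coe_eq_coe, Multiset.sort_eq, ← h.add_eq]
  simp

theorem exists_next (h : MergeState M T a b S) (hM : M.Pairwise (· ≤ ·)) (hT : T.Pairwise (· ≤ ·))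
    (hab : 0 < a + b) :
    (∃ b' u, b = b' + 1 ∧ T[b']? = some u ∧ ∀ x ∈ M.take a, x < u) ∨
      ∃ a' v, a = a' + 1 ∧ M[a']? = some v ∧ ∀ x ∈ T.take b, x ≤ v := by
  have := h.le_left
  have := h.le_right
  rcases a with - | a <;> rcases b with - | b
  · omega
  · exact .inl ⟨b, T[b], rfl, by simp, by simp⟩
  · exact .inr ⟨a, M[a], rfl, by simp, by simp⟩
  rcases lt_or_ge M[a] T[b] with hlt | hle
  · exact .inl ⟨b, T[b], rfl, by simp, fun x hx =>
      (le_of_mem_take_succ hM (by simp) hx).trans_lt hlt⟩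
  · exact .inr ⟨a, M[a], rfl, by simp, fun x hx =>
      (le_of_mem_take_succ hT (by simp) hx).trans hle⟩

end MergeState

end MergeState

/-- The keys `k` with the list `l` put into the cells from `a` on. -/
def Keys.write (k : Keys d) (a : ℕ) (l : List (Fin (2 ^ d))) : Keys d :=
  fun y => if a ≤ y ∧ y < a + l.length then l[y - a]? else k y

/-- The keys `k` with `b` cells from `a` on emptied, and followed by the list `S`. -/
def Keys.gap (k : Keys d) (a b : ℕ) (S : List (Fin (2 ^ d))) : Keys d :=
  fun y => if a ≤ y ∧ y < a + b then none else k.write (a + b) S y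

namespace Keys

variable {a b : ℕ} {S : List (Fin (2 ^ d))} {u v : Fin (2 ^ d)}

theorem gap_zero (k : Keys d) (a : ℕ) (S : List (Fin (2 ^ d))) : k.gap a 0 S = k.write a S := by
  funext y
  rw [gap, if_neg (by omega), add_zero]

theorem gap_nil (h : ∀ p < b, k (a + p) = none) : k.gap a b [] = k := by
  funext y
  simp only [gap, write, List.length_nil]
  split_ifs with hy hy'
  · obtain ⟨p, rfl⟩ := Nat.exists_eq_add_of_le hy.1
    exact (h p (by omega)).symm
  · omega
  · rfl

theorem update_gap_some (k : Keys d) (a b : ℕ) (u : Fin (2 ^ d)) (S : List (Fin (2 ^ d))) :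
    update (k.gap a (b + 1) S) (a + b) (some u) = k.gap a b (u :: S) := by
  funext y
  rcases lt_trichotomy y (a + b) with hy | rfl | hy
  · simp only [Function.update_of_ne hy.ne, gap, write, List.length_cons]
    split_ifs <;> first | rfl | omega
  · simp [gap, write]
  · obtain ⟨p, rfl⟩ := Nat.exists_eq_add_of_lt hy
    simp only [Function.update_of_ne hy.ne', gap, write, List.length_cons,
      show a + b + p + 1 - (a + b) = p + 1 by omega,
      show a + b + p + 1 - (a + (b + 1)) = p by omega, List.getElem?_cons_succ]
    split_ifs <;> first | rfl | omega

theorem gap_succ_left (k : Keys d) (a b : ℕ) (S : List (Fin (2 ^ d))) :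
    update (k.gap (a + 1) b S) a none = k.gap a (b + 1) S := by
  funext y
  rcases eq_or_ne y a with rfl | hy
  · simp [gap]
  · simp only [Function.update_of_ne hy, gap, write, show a + (b + 1) = a + 1 + b by omega]
    split_ifs <;> first | rfl | omega

/-- For `b = 0` both updates concern the same cell. -/
theorem update_update_gap (k : Keys d) (a b : ℕ) (v : Fin (2 ^ d)) (S : List (Fin (2 ^ d))) :
    update (update (k.gap (a + 1) b S) a (k.gap (a + 1) b S (a + b))) (a + b) (some v) =
      k.gap a b (v :: S) := by
  rw [← update_gap_some, ← gap_succ_left]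
  rcases b with - | b
  · simp
  · congr
    simp [gap, add_assoc]

end Keys

/-- Merge the keys of the source into the target, which is followed by room for them. -/
def mergeInto : Prog :=
  .seq (.instr (.add Reg.rem .left Reg.srcLen Reg.srcLen)) (.forLoop Reg.step Reg.total mergeStep)

/-- The cells from `src` on hold `T`, and those from `dst` on hold `M`, with room for `T` after it;
all of them are before `kb`. -/
structure MergeCells (kb : ℕ) (k : Keys d) (src dst : ℕ) (M T : List (Fin (2 ^ d))) : Prop where
  source : ∀ p < T.length, k (src + p) = T[p]?
  target : ∀ p < M.length + T.length, k (dst + p) = M[p]?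
  disjoint : ∀ p < T.length, ∀ q < M.length + T.length, src + p ≠ dst + q
  source_le : src + T.length ≤ kb
  target_le : dst + (M.length + T.length) ≤ kb

namespace MergeState

variable {src dst a b x : ℕ} {M T S : List (Fin (2 ^ d))} {u v : Fin (2 ^ d)}

theorem gap_source (h : MergeState M T a b S) (hk : MergeCells kb k src dst M T) {p : ℕ}
    (hp : p < T.length) : k.gap (dst + a) b S (src + p) = T[p]? := by
  have := h.length
  have hdis := hk.disjoint p hp (src + p - dst)
  rw [Keys.gap, if_neg (by omega), Keys.write, if_neg (by omega), hk.source p hp]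

theorem gap_target (h : MergeState M T a b S) (hk : MergeCells kb k src dst M T) {p : ℕ}
    (hp : p < a) : k.gap (dst + a) b S (dst + p) = M[p]? := by
  have := h.le_left
  rw [Keys.gap, if_neg (by omega), Keys.write, if_neg (by omega), hk.target p (by omega)]

theorem exec_cons_right (h : MergeState M T a (b + 1) S) (hk : MergeCells kb k src dst M T)
    (hr : MergeRegs r src dst T.length (M.length + T.length) S.length (b + 1))
    (hu : T[b]? = some u) (hlt : ∀ x ∈ M.take a, x < u) :
    Exec w kb mergeStep r (k.gap (dst + a) (b + 1) S) (update r Reg.rem b)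
      (k.gap (dst + a) b (u :: S)) 0 27 := by
  have length_eq := h.length
  have hb := h.le_right
  have := hk.source_le
  have := hk.target_le
  rw [show M.length + T.length = S.length + (a + b) + 1 by omega] at hr
  have h_step := hr.step_source (w := w) (kb := kb) hb ((h.gap_source hk hb).trans hu)
    (by simp [Keys.gap, add_assoc])
    (fun hba => ⟨M[a - 1]'(by have := h.le_left; omega), ?_, hlt _ ?_⟩) (by omega) (by omega)
  · rwa [← add_assoc dst, Keys.update_gap_some] at h_step
  · rw [show dst + (a + b) - (b + 1) = dst + (a - 1) by omega, h.gap_target hk (by omega)]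
    simp
  · exact List.mem_take_iff_getElem.2 ⟨a - 1, by have := h.le_left; omega, rfl⟩

theorem exec_cons_left (h : MergeState M T (a + 1) b S) (hk : MergeCells kb k src dst M T)
    (hr : MergeRegs r src dst T.length (M.length + T.length) S.length b)
    (hv : M[a]? = some v) (hle : ∀ x ∈ T.take b, x ≤ v) :
    Exec w kb mergeStep r (k.gap (dst + (a + 1)) b S) r (k.gap (dst + a) b (v :: S)) 0 27 := by
  have length_eq := h.length
  have ha := h.le_left
  have hb := h.le_right
  have := hk.source_le
  have := hk.target_le
  rw [show M.length + T.length = S.length + (a + b) + 1 by omega] at hr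
  have sub_eq : dst + (a + b) - b = dst + a := by omega
  have h_step := hr.step_target (w := w) (kb := kb) (k := k.gap (dst + (a + 1)) b S) (v := v) hb
    (by omega) (by rw [sub_eq, h.gap_target hk a.lt_succ_self, hv])
    (fun b' hb' => ⟨T[b'], by rw [h.gap_source hk (by omega)]; simp, hle _ ?_⟩)
    (fun hb => ⟨T[b], by rw [h.gap_source hk hb]; simp, h.left_lt v ?_ _ (by simp)⟩)
    (fun hb => ⟨hk.disjoint b hb _ (by omega), sub_eq ▸ hk.disjoint b hb _ (by omega)⟩)
    (by omega) (by omega)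
  · rwa [sub_eq, ← add_assoc, ← add_assoc, Keys.update_update_gap] at h_step
  · exact List.mem_take_iff_getElem.2 ⟨b', by omega, rfl⟩
  · simp [take_succ_eq_append hv]

theorem exec_next (h : MergeState M T a b S) (hk : MergeCells kb k src dst M T)
    (hr : MergeRegs r src dst T.length (M.length + T.length) S.length b)
    (hM : M.Pairwise (· ≤ ·)) (hT : T.Pairwise (· ≤ ·)) (hS : S.length < M.length + T.length) :
    ∃ a' b' S', MergeState M T a' b' S' ∧ S'.length = S.length + 1 ∧
      Exec w kb mergeStep r (k.gap (dst + a) b S) (update r Reg.rem b')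
        (k.gap (dst + a') b' S') 0 27 := by
  rcases h.exists_next hM hT (by have := h.length; omega) with
    ⟨b, u, rfl, hu, hlt⟩ | ⟨a, v, rfl, hv, hle⟩
  · exact ⟨a, b, u :: S, h.cons_right hT hu hlt, rfl, h.exec_cons_right hk hr hu hlt⟩
  · exact ⟨a, b, v :: S, h.cons_left hM hv hle, rfl,
      (h.exec_cons_left hk hr hv hle).congr (by rw [← hr.rem, Function.update_eq_self]) rfl⟩

end MergeState

theorem MergeRegs.update_step_rem {src dst srcLen total : ℕ}
    (h : MergeRegs r src dst srcLen total 0 0) (x b : ℕ) :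
    MergeRegs (update (update r Reg.rem b) Reg.step x) src dst srcLen total x b := by
  cases h
  constructor <;> simp [*]

theorem mergeInto_exec {src dst : ℕ} {M T : List (Fin (2 ^ d))}
    (hr : MergeRegs r src dst T.length (M.length + T.length) 0 0)
    (hk : MergeCells kb k src dst M T) (hM : M.Pairwise (· ≤ ·)) (hT : T.Pairwise (· ≤ ·)) :
    Exec w kb mergeInto r k r (k.write dst (M + T : Multiset (Fin (2 ^ d))).sort)
      (M.length + T.length) (30 * (M.length + T.length) + 4) := by
  obtain ⟨_, _, h_loop, a, b, S, rfl, h, hS, rfl⟩ := Exec.forLoop (w := w) (kb := kb)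
    (x := Reg.step) (y := Reg.total) (Q := mergeStep) (r := update r Reg.rem T.length) (k := k)
    (hi := 27) (by decide) (M.length + T.length)
    (fun x r' k' => ∃ a b S, r' = update r Reg.rem b ∧ MergeState M T a b S ∧ S.length = x ∧
      k' = k.gap (dst + a) b S) (fun _ => 0)
    (by rintro _ _ _ ⟨a, b, S, rfl, -⟩; simp [hr.step, hr.total])
    (by
      rintro _ hx _ _ ⟨a, b, S, rfl, h, rfl, rfl⟩
      obtain ⟨a', b', S', h', hS', h_step⟩ :=
        h.exec_next (w := w) hk (hr.update_step_rem S.length b) hM hT hx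
      refine ⟨update r Reg.rem b', _, h_step.congr ?_ rfl, a', b', S', rfl, h', hS', rfl⟩
      rw [Function.update_comm (by decide), Function.update_idem])
    ⟨M.length, T.length, [], rfl, .init M T, rfl, by
      rw [Keys.gap_nil]
      intro p hp
      rw [add_assoc, hk.target _ (by omega)]
      simp⟩
  obtain ⟨rfl, rfl⟩ : a = 0 ∧ b = 0 := by have := h.length; omega
  have h_rem : Exec w kb (.instr (.add Reg.rem .left Reg.srcLen Reg.srcLen)) r k
      (update r Reg.rem T.length) k 1 1 := .of_valid fun hvalid => by
    have := hvalid.fits Reg.srcLen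
    simpa [BinOp.eval, hr.rem, hr.srcLen] using Exec.add (w := w) (kb := kb) (k := k) (r := r)
      (x := Reg.rem) (y := Reg.srcLen) (z := Reg.srcLen) (op := .left) (by decide) (by decide)
      (by simpa [BinOp.eval, hr.rem])
  refine ((h_rem.seq h_loop).congr ?_ ?_).mono (by simp) (by omega)
  · rw [← hr.rem, Function.update_eq_self]
  · rw [add_zero, Keys.gap_zero, h.eq_sort]

/-! ### Sorted runs -/

section SortedRuns

variable {α : Type*} [LinearOrder α] {W i m m' p t : ℕ}

/-- The sorted list of `m` elements of `X` from the `i`-th one on, or as many as there are. -/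
def sortedSegment (X : List α) (i m : ℕ) : List α := Multiset.sort ((X.drop i).take m : List α)

@[simp]
theorem length_sortedSegment (X : List α) (i m : ℕ) :
    (sortedSegment X i m).length = min m (X.length - i) := by
  simp [sortedSegment]

theorem pairwise_sortedSegment (X : List α) (i m : ℕ) : (sortedSegment X i m).Pairwise (· ≤ ·) :=
  Multiset.pairwise_sort ..

theorem sort_sortedSegment_add (X : List α) (i m m' : ℕ) :
    (sortedSegment X i m + sortedSegment X (i + m) m' : Multiset α).sort =
      sortedSegment X i (m + m') := by
  simp only [sortedSegment, Multiset.sort_eq, Multiset.coe_add, List.take_add, List.drop_drop]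

theorem sortedSegment_congr {X : List α} (h : min m (X.length - i) = min m' (X.length - i)) :
    sortedSegment X i m = sortedSegment X i m' := by
  rw [sortedSegment, sortedSegment, List.take_eq_take_iff.2 (by simpa using h)]

theorem sortedSegment_take (X : List α) (t i m : ℕ) :
    sortedSegment (X.take t) i m = sortedSegment X i (min m (t - i)) := by
  rw [sortedSegment, List.drop_take, List.take_take, sortedSegment]

/-- The list `X` with its segments of length `W` sorted, as a sequence of cells. -/
def sortedRuns (W : ℕ) (X : List α) (p : ℕ) : Option α := (sortedSegment X (p / W * W) W)[p % W]?

theorem sortedRuns_mul_add (X : List α) (i : ℕ) (hp : p < W) :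
    sortedRuns W X (i * W + p) = (sortedSegment X (i * W) W)[p]? := by
  rw [sortedRuns, add_comm, Nat.add_mul_div_right _ _ (by omega), Nat.add_mul_mod_self_right,
    Nat.mod_eq_of_lt hp, Nat.div_eq_of_lt hp, zero_add]

theorem sortedRuns_eq_none {X : List α} (hp : X.length ≤ p) : sortedRuns W X p = none := by
  have := Nat.div_add_mod' p W
  rw [sortedRuns, List.getElem?_eq_none_iff, length_sortedSegment]
  omega

theorem sortedRuns_one (X : List α) (p : ℕ) : sortedRuns 1 X p = X[p]? := by
  rcases lt_or_ge p X.length with hp | hp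
  · rw [sortedRuns, Nat.div_one, Nat.mul_one, Nat.mod_one, sortedSegment,
      List.drop_eq_getElem_cons hp, List.take_succ_cons, List.take_zero, Multiset.coe_singleton,
      Multiset.sort_singleton, List.getElem?_cons_zero, List.getElem?_eq_getElem hp]
  · rw [sortedRuns_eq_none hp, List.getElem?_eq_none hp]

theorem sortedRuns_take_mul_add {X : List α} (ht : t ≤ i * W + W) (hp : p < W) :
    sortedRuns W (X.take t) (i * W + p) = (sortedSegment X (i * W) (t - i * W))[p]? := by
  rw [sortedRuns_mul_add _ _ hp, sortedSegment_take, Nat.min_eq_right (by omega)]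

theorem sortedRuns_take_of_le {X : List α} {t' : ℕ} (hit : i * W ≤ t) (htt' : t ≤ t')
    (hp : p < i * W ∨ t' ≤ p) : sortedRuns W (X.take t') p = sortedRuns W (X.take t) p := by
  rcases hp with hp | hp
  · have lt_i : p / W < i := Nat.div_lt_of_lt_mul (by rwa [mul_comm])
    have le_mul : (p / W + 1) * W ≤ i * W := Nat.mul_le_mul_right W lt_i
    rw [Nat.succ_mul] at le_mul
    rw [sortedRuns, sortedRuns, sortedSegment_take, sortedSegment_take,
      Nat.min_eq_left (by omega), Nat.min_eq_left (by omega)]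
  · rw [sortedRuns_eq_none, sortedRuns_eq_none] <;> rw [List.length_take] <;> omega

end SortedRuns

/-! ### Bottom-up merge sort that keeps all levels -/

/-- The keys during the sorting of the list `X` in levels of `B` cells from `base` on: those up to
the `l`-th one are complete, where the runs of the `i`-th level have length `2 ^ i`, and the next
one contains the sorted runs of the first `t` elements. -/
def Keys.levels (k : Keys d) (base B : ℕ) (X : List (Fin (2 ^ d))) (l t : ℕ) : Keys d := fun y =>
  if y < base then k y else
    sortedRuns (2 ^ ((y - base) / B)) (if (y - base) / B ≤ l then X else
      if (y - base) / B = l + 1 then X.take t else []) ((y - base) % B)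

namespace Keys

variable {base B l t i j p y : ℕ} {X : List (Fin (2 ^ d))}

theorem levels_of_lt (hy : y < base) : k.levels base B X l t y = k y := if_pos hy

theorem levels_add (hp : p < B) : k.levels base B X l t (base + i * B + p) =
    sortedRuns (2 ^ i) (if i ≤ l then X else if i = l + 1 then X.take t else []) p := by
  have div_eq : (base + i * B + p - base) / B = i := by
    rw [add_assoc, Nat.add_sub_cancel_left, add_comm, Nat.add_mul_div_right _ _ (by omega),
      Nat.div_eq_of_lt hp, zero_add]
  have mod_eq : (base + i * B + p - base) % B = p := by
    rw [add_assoc, Nat.add_sub_cancel_left, add_comm, Nat.add_mul_mod_self_right,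
      Nat.mod_eq_of_lt hp]
  rw [levels, if_neg (by omega), div_eq, mod_eq]

theorem levels_add_of_le (hp : p < B) (hi : i ≤ l) :
    k.levels base B X l t (base + i * B + p) = sortedRuns (2 ^ i) X p := by
  rw [levels_add hp, if_pos hi]

theorem levels_add_succ (hp : p < B) :
    k.levels base B X l t (base + (l + 1) * B + p) = sortedRuns (2 ^ (l + 1)) (X.take t) p := by
  rw [levels_add hp, if_neg (by omega), if_pos rfl]

theorem levels_length (k : Keys d) (base B l : ℕ) (X : List (Fin (2 ^ d))) :
    k.levels base B X l X.length = k.levels base B X (l + 1) 0 := by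
  funext y
  simp only [levels, List.take_length, List.take_zero, ite_self]
  split_ifs <;> first | rfl | omega

theorem exists_eq_add_mul_add (hB : 0 < B) (hy : base ≤ y) :
    ∃ i p, p < B ∧ y = base + i * B + p :=
  ⟨(y - base) / B, (y - base) % B, Nat.mod_lt _ hB, by
    have := Nat.div_add_mod' (y - base) B
    omega⟩

theorem write_eq_levels (hB : 0 < B) (hX : X.length ≤ B) (hk : ∀ y, base ≤ y → k y = none) :
    k.write base X = k.levels base B X 0 0 := by
  funext y
  rcases lt_or_ge y base with hy | hy
  · rw [write, if_neg (by omega), levels_of_lt hy]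
  obtain ⟨i, p, hp, rfl⟩ := exists_eq_add_mul_add hB hy
  rw [levels_add hp, write, hk _ hy]
  rcases i with - | i
  · rw [if_pos le_rfl, pow_zero, sortedRuns_one]
    split_ifs with hpX
    · congr 1
      omega
    · rw [List.getElem?_eq_none (by omega)]
  · rw [if_neg (by rw [Nat.succ_mul]; omega), if_neg (by omega), List.take_zero, ite_self,
      sortedRuns_eq_none (by simp)]

theorem levels_write (hB : 0 < B) (hX : X.length ≤ B) (hj : j * 2 ^ l ≤ X.length)
    (hi : i * 2 ^ (l + 1) ≤ j * 2 ^ l) (hji : (j + 1) * 2 ^ l ≤ (i + 1) * 2 ^ (l + 1)) :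
    (k.levels base B X l (j * 2 ^ l)).write (base + (l + 1) * B + i * 2 ^ (l + 1))
      (sortedSegment X (i * 2 ^ (l + 1)) ((j + 1) * 2 ^ l - i * 2 ^ (l + 1))) =
      k.levels base B X l (min ((j + 1) * 2 ^ l) X.length) := by
  rw [Nat.succ_mul j, Nat.succ_mul i] at hji
  rw [Nat.succ_mul j]
  funext y
  rcases lt_or_ge y base with hy | hy
  · rw [write, if_neg (by omega), levels_of_lt hy, levels_of_lt hy]
  obtain ⟨i', p, hp, rfl⟩ := exists_eq_add_mul_add hB hy
  simp only [write, length_sortedSegment]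
  rcases lt_trichotomy i' (l + 1) with hl | rfl | hl
  · have := Nat.mul_le_mul_right B (Nat.succ_le_of_lt hl)
    rw [Nat.succ_mul] at this
    rw [if_neg (by omega), levels_add_of_le hp (by omega), levels_add_of_le hp (by omega)]
  · rw [levels_add_succ hp, levels_add_succ hp]
    split_ifs with hy'
    · obtain ⟨q, rfl⟩ := Nat.exists_eq_add_of_le (show i * 2 ^ (l + 1) ≤ p by omega)
      rw [sortedRuns_take_mul_add (by omega) (by omega), ← Nat.add_assoc, Nat.add_sub_cancel_left]
      exact congrArg (·[q]?) (sortedSegment_congr (by omega))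
    · exact (sortedRuns_take_of_le hi (by omega) (by omega)).symm
  · have := Nat.mul_le_mul_right B (Nat.succ_le_of_lt hl)
    rw [Nat.succ_mul (l + 1)] at this
    rw [if_neg (by omega), levels_add hp, levels_add hp]
    simp only [show ¬ i' ≤ l by omega, hl.ne', if_false]

end Keys

/-- Copy the current block into the first level. -/
def copyBlock : Prog :=
  .forLoop Reg.run Reg.blockLen <|
    .conj (.ofList [.add Reg.src .add Reg.blockStart Reg.run, .add Reg.dst .add Reg.work Reg.run])
      (.instr (.keyCopy Reg.src Reg.dst))

/-- Compute the parameters for merging the current run into the next level. -/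
def runParams : List Instr :=
  [.add Reg.runOffset .mul Reg.run Reg.runLen, .add Reg.runRest .sub Reg.blockLen Reg.runOffset,
    .add Reg.runExcess .sub Reg.runLen Reg.runRest, .add Reg.srcLen .sub Reg.runLen Reg.runExcess,
    .add Reg.src .add Reg.levelStart Reg.runOffset, .add Reg.parity .land Reg.run Reg.one,
    .add Reg.dstLen .mul Reg.parity Reg.runLen, .add Reg.dst .add Reg.nextStart Reg.runOffset,
    .sub Reg.dst .left Reg.dstLen Reg.dstLen, .add Reg.total .add Reg.dstLen Reg.srcLen]

/-- Merge the current run into the next level: a run of even index into an empty run, and one of odd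
index into the run that has just received the run before. -/
def mergeRun : Prog := .conj (.ofList runParams) mergeInto

/-- Compute the parameters of the current level. -/
def levelParams : List Instr :=
  [.add Reg.levelStart .mul Reg.level Reg.blockSize,
    .add Reg.levelStart .left Reg.work Reg.work,
    .add Reg.nextStart .add Reg.levelStart Reg.blockSize,
    .add Reg.runLen .shl Reg.one Reg.level, .add Reg.lastIdx .sub Reg.blockLen Reg.one,
    .add Reg.runs .shr Reg.lastIdx Reg.level, .addC Reg.runs 1]

/-- Merge the runs of the current level into the next one. -/
def mergeLevel : Prog := .conj (.ofList levelParams) (.forLoop Reg.run Reg.runs mergeRun)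

/-- Sort the current block into the last level, keeping the levels before. -/
def sortBlock : Prog := copyBlock.seq (.forLoop Reg.level Reg.levels mergeLevel)

namespace Keys

variable {base B l i j kb : ℕ} {X : List (Fin (2 ^ d))}

theorem write_nil (k : Keys d) (a : ℕ) : k.write a [] = k := by
  funext y
  exact if_neg (by simp)

theorem update_write_take (hi : i < X.length) (a : ℕ) :
    update (k.write a (X.take i)) (a + i) X[i]? = k.write a (X.take (i + 1)) := by
  funext y
  simp only [Function.update_apply, write, List.length_take]
  split_ifs with h₁ h₂ h₂ h₃ h₃
  · rw [h₁, Nat.add_sub_cancel_left, List.getElem?_take_of_lt i.lt_succ_self]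
  · omega
  · rw [List.getElem?_take_of_lt (by omega), List.getElem?_take_of_lt (by omega)]
  · omega
  · omega
  · rfl

theorem mergeCells_levels (hX : X.length ≤ B) (hj : j * 2 ^ l ≤ X.length)
    (hi : i * 2 ^ (l + 1) ≤ j * 2 ^ l) (hji : (j + 1) * 2 ^ l ≤ (i + 1) * 2 ^ (l + 1))
    (hkb : base + (l + 1) * B + B ≤ kb) :
    MergeCells kb (k.levels base B X l (j * 2 ^ l)) (base + l * B + j * 2 ^ l)
      (base + (l + 1) * B + i * 2 ^ (l + 1))
      (sortedSegment X (i * 2 ^ (l + 1)) (j * 2 ^ l - i * 2 ^ (l + 1)))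
      (sortedSegment X (j * 2 ^ l) (2 ^ l)) := by
  rw [Nat.succ_mul j, Nat.succ_mul i] at hji
  have hlB : (l + 1) * B = l * B + B := Nat.succ_mul l B
  constructor <;> simp only [length_sortedSegment]
  · intro p hp
    rw [add_assoc, levels_add_of_le (by omega) le_rfl, sortedRuns_mul_add _ _ (by omega)]
  · intro p hp
    rw [add_assoc _ _ p, levels_add_succ (by omega),
      sortedRuns_take_mul_add (by omega) (by omega)]
  all_goals omega

end Keys

/-- The registers during the sorting of a block of length `len` from cell `off` on into levels of
`B` cells from `base` on. -/
structure SortRegs (r : Regs) (levels B off len base : ℕ) : Prop where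
  one : r Reg.one = 1
  levels : r Reg.levels = levels
  blockSize : r Reg.blockSize = B
  work : r Reg.work = base
  blockStart : r Reg.blockStart = off
  blockLen : r Reg.blockLen = len
  zero : ∀ y, 12 ≤ y → r y = 0

/-- The registers during the merging of the runs of length `W` of a level from cell `src` on into
the one from cell `dst` on, where `j` is the index of the current run. -/
structure LevelRegs (r : Regs) (len W src dst j : ℕ) : Prop where
  one : r Reg.one = 1
  blockLen : r Reg.blockLen = len
  levelStart : r Reg.levelStart = src
  nextStart : r Reg.nextStart = dst
  runLen : r Reg.runLen = W
  run : r Reg.run = j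
  zero : ∀ y, 19 ≤ y → r y = 0

section SortBlock

variable {e B off len base l W src dst i j : ℕ} {X : List (Fin (2 ^ d))}

theorem copyBlock_exec (h : SortRegs r e B off X.length base)
    (hX : ∀ p < X.length, k (off + p) = X[p]?) (hk : ∀ y, base ≤ y → k y = none)
    (hoff : off + X.length ≤ base) (hkb : base + X.length ≤ kb) :
    Exec w kb copyBlock r k r (k.write base X) 0 (8 * X.length + 3) := by
  refine .of_valid fun ⟨_, hkw, _⟩ => ?_
  have h_loop : Exec w kb copyBlock r (k.write base (X.take 0)) r
      (k.write base (X.take X.length)) _ (X.length * (5 + 3) + 3) :=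
    Exec.forLoop_keys (by decide) (fun i => k.write base (X.take i)) (fun _ => 0)
      (h.zero _ (by decide)) h.blockLen fun i hi => ?_
  · rw [List.take_length, List.take_zero, Keys.write_nil] at h_loop
    exact h_loop.mono
  refine (Exec.conj_ofList (lo := 1) (hi := 1)
    (.add (v := off + i) (by simp [BinOp.eval, h.blockStart, h.zero]) (by omega) <|
      .add (v := base + i) (by simp [BinOp.eval, h.work, h.zero]) (by omega) .nil)
    ((Exec.keyCopy (u := X[i]) ?_ ?_ ?_ ?_).congr rfl ?_)).mono (by omega) le_rfl
  · have : ¬ base ≤ off + i := by omega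
    simpa [Keys.write, this, hi] using hX i hi
  · simpa [Keys.write, hi.le] using hk (base + i) (by omega)
  · exact (by omega : off + i < kb)
  · exact (by omega : base + i < kb)
  · simp [← Keys.update_write_take hi, hi]

theorem LevelRegs.computes_runParams (h : LevelRegs r len W src dst j) (hw : 1 ≤ w)
    (hW : W < 2 ^ w) (hsrc : src + len < 2 ^ w) (hdst : dst + len < 2 ^ w) (hj : j * W ≤ len) :
    ∃ r', Computes w runParams r r' ∧
      MergeRegs r' (src + j * W) (dst + (j * W - j % 2 * W)) (min W (len - j * W))
        (j % 2 * W + min W (len - j * W)) 0 0 := by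
  obtain ⟨h_one, h_blockLen, h_levelStart, h_nextStart, h_runLen, h_run, h_zero⟩ := h
  have hjW : j % 2 * W ≤ j * W := Nat.mul_le_mul_right W (Nat.mod_le j 2)
  have two_le : 2 ^ 1 ≤ 2 ^ w := Nat.pow_le_pow_right two_pos hw
  refine ⟨_, .add (v := j * W) (by simp [BinOp.eval, *]) (by omega) <|
    .add (v := len - j * W) (by simp [BinOp.eval, *]) (by omega) <|
    .add (v := W - (len - j * W)) (by simp [BinOp.eval, *]) (by omega) <|
    .add (v := min W (len - j * W)) (by simp [BinOp.eval, Nat.sub_sub_eq_min, *]) (by omega) <|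
    .add (v := src + j * W) (by simp [BinOp.eval, *]) (by omega) <|
    .add (v := j % 2) (by simp [BinOp.eval, Nat.and_one_is_mod, *]) (by omega) <|
    .add (v := j % 2 * W) (by simp [BinOp.eval, *]) (by omega) <|
    .add (v := dst + j * W) (by simp [BinOp.eval, *]) (by omega) <|
    .sub (v := dst + (j * W - j % 2 * W))
      (by simp [BinOp.eval, add_assoc, Nat.sub_add_cancel hjW]) <|
    .add (v := j % 2 * W + min W (len - j * W)) (by simp [BinOp.eval, *]) (by omega) .nil, ?_⟩
  constructor <;> simp [h_one, h_zero]

theorem mod_two_mul_le (j W : ℕ) : j % 2 * W ≤ W := by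
  simpa using Nat.mul_le_mul_right W (Nat.le_of_lt_succ (Nat.mod_lt j two_pos))

theorem mergeRun_exec
    (h : LevelRegs r X.length (2 ^ l) (base + l * B) (base + (l + 1) * B) j)
    (hB : 0 < B) (hX : X.length ≤ B) (hj : j * 2 ^ l ≤ X.length)
    (hkb : base + (l + 1) * B + B ≤ kb) (hlb : 2 ^ l ≤ kb) :
    Exec w kb mergeRun r (k.levels base B X l (j * 2 ^ l)) r
      (k.levels base B X l (min ((j + 1) * 2 ^ l) X.length)) 0 (30 * min (2 * 2 ^ l) B + 24) := by
  refine .of_valid fun ⟨hw, hkw, _⟩ => ?_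
  have hlB : (l + 1) * B = l * B + B := Nat.succ_mul l B
  obtain ⟨r', h_comp, hr'⟩ := h.computes_runParams (w := w) hw (by omega) (by omega) (by omega) hj
  have mod_mul_le := mod_two_mul_le j (2 ^ l)
  have mul_eq : j * 2 ^ l = j / 2 * 2 ^ (l + 1) + j % 2 * 2 ^ l := by
    conv_lhs => rw [← Nat.div_add_mod' j 2]
    ring
  have : 2 ^ (l + 1) = 2 * 2 ^ l := Nat.pow_succ'
  have succ_mul_le : (j + 1) * 2 ^ l ≤ (j / 2 + 1) * 2 ^ (l + 1) := by
    rw [Nat.succ_mul, Nat.succ_mul]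
    omega
  have h_cells := Keys.mergeCells_levels (k := k) hX hj (by omega) succ_mul_le hkb
  have length_left : (sortedSegment X (j / 2 * 2 ^ (l + 1))
      (j * 2 ^ l - j / 2 * 2 ^ (l + 1))).length = j % 2 * 2 ^ l := by
    rw [length_sortedSegment]
    omega
  have h_merge := mergeInto_exec (w := w) (r := r') (by
    rwa [length_left, length_sortedSegment,
      show j / 2 * 2 ^ (l + 1) = j * 2 ^ l - j % 2 * 2 ^ l by omega]) h_cells
    (pairwise_sortedSegment ..) (pairwise_sortedSegment ..)
  refine (Exec.conj_ofList h_comp (h_merge.congr rfl ?_)).mono (Nat.zero_le _) ?_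
  · rw [← Keys.levels_write hB hX hj (by omega) succ_mul_le,
      Nat.succ_mul j, Nat.sub_add_comm (by omega), ← sort_sortedSegment_add,
      Nat.add_sub_cancel' (by omega)]
  · simp only [length_left, length_sortedSegment, runParams, List.length_cons, List.length_nil]
    omega

theorem runs_mul_le (hW : 0 < W) (hlen : len ≤ B) :
    ((len - 1) / W + 1) * min (2 * W) B ≤ 4 * B := by
  rcases Nat.lt_or_ge (len - 1) W with h | h
  · rw [Nat.div_eq_of_lt h]
    omega
  · have := Nat.div_mul_le_self (len - 1) W
    calc ((len - 1) / W + 1) * min (2 * W) B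
      _ ≤ ((len - 1) / W + 1) * (2 * W) := Nat.mul_le_mul_left _ (min_le_left _ _)
      _ = 2 * ((len - 1) / W * W) + 2 * W := by ring
      _ ≤ 4 * B := by omega

theorem SortRegs.computes_levelParams (h : SortRegs r e B off len base) (l : ℕ)
    (hB : base + l * B + B < 2 ^ w) (hlen : len + 1 < 2 ^ w) (hl : 2 ^ l < 2 ^ w) :
    ∃ r', Computes w levelParams (update r Reg.level l) r' ∧ r' Reg.run = 0 ∧
      r' Reg.runs = (len - 1) / 2 ^ l + 1 ∧
      ∀ j, LevelRegs (update r' Reg.run j) len (2 ^ l) (base + l * B) (base + (l + 1) * B) j := by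
  obtain ⟨h_one, -, h_blockSize, h_work, -, h_blockLen, h_zero⟩ := h
  have div_le : (len - 1) / 2 ^ l ≤ len - 1 := Nat.div_le_self ..
  rw [Nat.succ_mul, ← add_assoc]
  refine ⟨_, .add (v := l * B) (by simp [BinOp.eval, *]) (by omega) <|
    .add (v := base + l * B) (by simp [BinOp.eval, h_work, add_comm]) (by omega) <|
    .add (v := base + l * B + B) (by simp [BinOp.eval, *]) (by omega) <|
    .add (v := 2 ^ l) (by simp [BinOp.eval, Nat.shiftLeft_eq, *]) hl <|
    .add (v := len - 1) (by simp [BinOp.eval, *]) (by omega) <|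
    .add (v := (len - 1) / 2 ^ l) (by simp [BinOp.eval, Nat.shiftRight_eq_div_pow, *])
      (by omega) <|
    .addC (v := (len - 1) / 2 ^ l + 1) (by simp) (by omega) .nil, ?_, by simp, fun j => ?_⟩
  · simp [h_zero]
  constructor
  case zero =>
    intro y hy
    have : y ≠ 18 ∧ y ≠ 17 ∧ y ≠ 16 ∧ y ≠ 15 ∧ y ≠ 14 ∧ y ≠ 13 ∧ y ≠ 12 := by omega
    simp [this, h_zero y (by omega)]
  all_goals simp [h_one, h_blockLen]

theorem mergeLevel_exec (h : SortRegs r e B off X.length base) (hB : 0 < B) (hX : X.length ≤ B)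
    (hkb : base + (l + 1) * B + B ≤ kb) (hlb : 2 ^ l ≤ kb) :
    Exec w kb mergeLevel (update r Reg.level l) (k.levels base B X l 0) (update r Reg.level l)
      (k.levels base B X (l + 1) 0) 0 (200 * B) := by
  refine .of_valid fun ⟨_, hkw, _⟩ => ?_
  have hlB : (l + 1) * B = l * B + B := Nat.succ_mul l B
  have hW : 0 < 2 ^ l := Nat.two_pow_pos l
  have div_mul_le : (X.length - 1) / 2 ^ l * 2 ^ l ≤ X.length - 1 := Nat.div_mul_le_self ..
  obtain ⟨r₁, h_comp, h_run, h_runs, h_regs⟩ := h.computes_levelParams (w := w) l (by omega)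
    (by omega) (by omega)
  have h_loop : Exec w kb (.forLoop Reg.run Reg.runs mergeRun) r₁ _ r₁ _ 0
      (((X.length - 1) / 2 ^ l + 1) * (30 * min (2 * 2 ^ l) B + 24 + 3) + 3) :=
    (Exec.forLoop_keys (by decide)
      (fun j => k.levels base B X l (min (j * 2 ^ l) X.length)) (fun _ => 0) h_run h_runs
      fun j hj => ?_).mono (Nat.zero_le _) le_rfl
  · have min_eq : min (((X.length - 1) / 2 ^ l + 1) * 2 ^ l) X.length = X.length := by
      have := Nat.lt_mul_div_succ (X.length - 1) hW
      rw [mul_comm] at this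
      omega
    rw [zero_mul, Nat.zero_min, min_eq, Keys.levels_length] at h_loop
    refine (Exec.conj_ofList h_comp h_loop).mono le_rfl ?_
    have h_time := runs_mul_le hW hX
    have runs_le : (X.length - 1) / 2 ^ l ≤ X.length - 1 := Nat.div_le_self ..
    simp only [levelParams, List.length_cons, List.length_nil]
    linarith [show X.length - 1 + 1 ≤ B by omega]
  · have hj' : j * 2 ^ l ≤ (X.length - 1) / 2 ^ l * 2 ^ l :=
      Nat.mul_le_mul_right _ (Nat.le_of_lt_succ hj)
    rw [Nat.min_eq_left (by omega)]
    exact mergeRun_exec (h_regs j) hB hX (by omega) hkb hlb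

theorem sortBlock_exec (h : SortRegs r e B off X.length base) (he : 0 < e) (hB : 0 < B)
    (hXB : X.length ≤ B) (hX : ∀ p < X.length, k (off + p) = X[p]?)
    (hk : ∀ y, base ≤ y → k y = none) (hoff : off + X.length ≤ base)
    (hkb : base + (e + 1) * B ≤ kb) (hekb : 2 ^ e ≤ kb) :
    Exec w kb sortBlock r k r (k.levels base B X e 0) 0 (220 * (e * B)) := by
  rw [Nat.succ_mul] at hkb
  have le_mul : B ≤ e * B := Nat.le_mul_of_pos_left B he
  have h_copy := copyBlock_exec (w := w) (kb := kb) h hX hk hoff (by omega)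
  rw [Keys.write_eq_levels hB hXB hk] at h_copy
  refine (h_copy.seq (Exec.forLoop_keys (hi := 200 * B) (by decide)
    (fun l => k.levels base B X l 0) (fun _ => 0) (h.zero _ le_rfl) h.levels fun l hl => ?_)).mono
    (Nat.zero_le _) (by nlinarith)
  refine mergeLevel_exec h hB hXB ?_ ((Nat.pow_le_pow_right two_pos hl.le).trans hekb)
  have : (l + 1) * B ≤ e * B := Nat.mul_le_mul_right B hl
  omega

end SortBlock

/-! ### Merging the sorted blocks into the output -/

/-- Double the power of two and increase its exponent. -/
def doubling : List Instr :=
  [.sub Reg.twoPow .shl Reg.one Reg.levels, .addC Reg.levels 1,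
    .add Reg.twoPow .shl Reg.one Reg.levels]

/-- Compute the binary length of `n`. -/
def binaryLength : Prog :=
  .loop (.eqC Reg.levels 0) .skip (.ofList doubling) (.lt Reg.n Reg.twoPow)

/-- Compute the length of the blocks and the address of the working storage. -/
def mainParams : List Instr :=
  [.add Reg.blockSize .div Reg.n Reg.levels, .addC Reg.blockSize 1,
    .add Reg.work .add Reg.n Reg.n]

/-- Compute the parameters of the sorting program. -/
def setup : Prog :=
  .seq (.ofList [.addC Reg.one 1, .addC Reg.twoPow 1]) (binaryLength.seq (.ofList mainParams))

/-- Compute the address and the length of the current block. -/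
def blockParams : List Instr :=
  [.add Reg.blockStart .mul Reg.block Reg.blockSize,
    .add Reg.blockRest .sub Reg.n Reg.blockStart,
    .add Reg.blockExcess .sub Reg.blockSize Reg.blockRest,
    .add Reg.blockLen .sub Reg.blockSize Reg.blockExcess]

/-- Compute the parameters for merging the sorted block into the output. -/
def outputParams : List Instr :=
  [.add Reg.srcLen .left Reg.blockLen Reg.blockLen, .add Reg.src .mul Reg.levels Reg.blockSize,
    .add Reg.src .left Reg.work Reg.work, .add Reg.dst .left Reg.n Reg.n,
    .add Reg.outExcess .sub Reg.blockStart Reg.n,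
    .add Reg.total .sub Reg.blockStart Reg.outExcess,
    .add Reg.total .left Reg.blockLen Reg.blockLen]

/-- Merge the current block into the output: sort it, merge the last level, and undo the sorting. -/
def processBlock : Prog :=
  .conj (.ofList blockParams) (.conj sortBlock (.conj (.ofList outputParams) mergeInto))

/-- The sorting program. -/
def sortProg : Prog := .conj setup (.forLoop Reg.block Reg.levels processBlock)

/-- The registers after `setup`, for `n` keys in `e` blocks of length at most `B`. -/
structure MainRegs (r : Regs) (n e B : ℕ) : Prop where
  work : r Reg.work = 2 * n
  n : r Reg.n = n
  one : r Reg.one = 1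
  levels : r Reg.levels = e
  blockSize : r Reg.blockSize = B
  zero : ∀ y, 7 ≤ y → r y = 0

section SortProg

variable {n e B i off len t base : ℕ} {L X : List (Fin (2 ^ d))}

theorem computes_doubling (h_one : r Reg.one = 1) (hi : 2 ^ (i + 1) < 2 ^ w) :
    Computes w doubling (update (update r Reg.levels i) Reg.twoPow (2 ^ i))
      (update (update r Reg.levels (i + 1)) Reg.twoPow (2 ^ (i + 1))) := by
  have h : Computes w doubling (update (update r Reg.levels i) Reg.twoPow (2 ^ i)) _ :=
    .sub (v := 0) (by simp [BinOp.eval, h_one, Nat.shiftLeft_eq]) <|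
    .addC (v := i + 1) (by simp) (i.succ.lt_two_pow_self.trans hi) <|
    .add (v := 2 ^ (i + 1)) (by simp [BinOp.eval, h_one, Nat.shiftLeft_eq]) hi .nil
  convert h using 1
  funext y
  simp only [Function.update_apply]
  split_ifs <;> rfl

theorem binaryLength_exec (h_one : r Reg.one = 1) (h_levels : r Reg.levels = 0)
    (h_twoPow : r Reg.twoPow = 1) (hn : 2 ^ (r Reg.n).size < 2 ^ w) :
    Exec w kb binaryLength r k
      (update (update r Reg.levels (r Reg.n).size) Reg.twoPow (2 ^ (r Reg.n).size)) k 0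
      (5 * (r Reg.n).size + 2) := by
  obtain ⟨_, _, h, rfl, rfl⟩ := Exec.loop (w := w) (kb := kb) (t := .eqC Reg.levels 0)
    (u := .lt Reg.n Reg.twoPow) (Q := .ofList doubling) (r := r) (k := k) (hi := 3) (r Reg.n).size
    (fun i r' k' => r' = update (update r Reg.levels i) Reg.twoPow (2 ^ i) ∧ k' = k) (fun _ => 0)
    (by rintro i _ _ ⟨rfl, -⟩; simp [Test.holds, State.blank])
    (by
      rintro i _ _ hi ⟨rfl, -⟩
      simpa [Test.holds, State.blank, ← Nat.size_le] using hi.ge_iff_eq)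
    (by
      rintro i hi _ _ ⟨rfl, rfl⟩
      exact ⟨_, _, (computes_doubling h_one
        ((Nat.pow_le_pow_right two_pos hi).trans_lt hn)).exec _, rfl, rfl⟩)
    ⟨by rw [pow_zero, ← h_levels, Function.update_eq_self, ← h_twoPow, Function.update_eq_self],
      rfl⟩
  exact h.mono (Nat.zero_le _)

theorem two_pow_size_le (hn : n ≠ 0) : 2 ^ n.size ≤ 2 * n := by
  obtain ⟨m, hm⟩ := Nat.exists_eq_succ_of_ne_zero (Nat.size_pos.2 hn.bot_lt).ne'
  rw [hm, Nat.pow_succ']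
  exact Nat.mul_le_mul_left 2 (Nat.lt_size.1 (hm ▸ m.lt_succ_self))

theorem computes_mainParams (h_n : r Reg.n ≠ 0) (h_one : r Reg.one = 1)
    (h_levels : r Reg.levels = e) (h_zero : ∀ y, 5 ≤ y → r y = 0) (hw : 2 * r Reg.n < 2 ^ w) :
    ∃ r', Computes w mainParams r r' ∧ MainRegs r' (r Reg.n) e (r Reg.n / e + 1) := by
  have div_le : r Reg.n / e ≤ r Reg.n := Nat.div_le_self ..
  refine ⟨_, .add (v := r Reg.n / e) (by simp [BinOp.eval, *]) (by omega) <|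
    .addC (v := r Reg.n / e + 1) (by simp) (by omega) <|
    .add (v := 2 * r Reg.n) (by simp [BinOp.eval, h_zero, two_mul]) (by omega) .nil, ?_⟩
  constructor
  case zero =>
    intro y hy
    have : y ≠ 6 ∧ y ≠ 5 := by omega
    simp [this, h_zero y (by omega)]
  all_goals simp [h_one, h_levels]

theorem setup_exec (h_n : r Reg.n = n) (hn : n ≠ 0) (h_zero : ∀ y, 2 ≤ y → r y = 0)
    (hw : 2 * n < 2 ^ w) :
    ∃ r', (∀ k : Keys d, Exec w kb setup r k r' k 0 (5 * n.size + 7)) ∧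
      MainRegs r' n n.size (n / n.size + 1) := by
  subst h_n
  have h_consts : Computes w [.addC Reg.one 1, .addC Reg.twoPow 1] r
      (update (update r Reg.one 1) Reg.twoPow 1) :=
    .addC (by simp [h_zero]) (by omega) <| .addC (by simp [h_zero]) (by omega) .nil
  have h_length (k : Keys d) := binaryLength_exec (kb := kb) (w := w) (k := k)
    (r := update (update r Reg.one 1) Reg.twoPow 1) (by simp) (by simp [h_zero]) (by simp)
    (by simpa using (two_pow_size_le hn).trans_lt hw)
  obtain ⟨r', h_params, hr'⟩ := computes_mainParams (w := w) (e := (r Reg.n).size)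
    (r := update (update (update (update r Reg.one 1) Reg.twoPow 1) Reg.levels (r Reg.n).size)
      Reg.twoPow (2 ^ (r Reg.n).size)) (by simpa using hn) (by simp) (by simp)
    (fun y hy => by
      have : y ≠ 2 ∧ y ≠ 3 ∧ y ≠ 4 := by omega
      simp [this, h_zero y (by omega)])
    (by simpa using hw)
  exact ⟨r', fun k => ((h_consts.exec k).seq ((h_length k).seq (h_params.exec k))).mono
    (Nat.zero_le _) (by simp +arith [mainParams]), by simpa using hr'⟩

theorem MainRegs.computes_blockParams (h : MainRegs r n e B) (hB : B < 2 ^ w) (hn : n < 2 ^ w)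
    (hi : i * B < 2 ^ w) :
    ∃ r', Computes w blockParams (update r Reg.block i) r' ∧ r' Reg.n = n ∧
      SortRegs r' e B (i * B) (min B (n - i * B)) (2 * n) := by
  obtain ⟨h_work, h_n, h_one, h_levels, h_blockSize, h_zero⟩ := h
  refine ⟨_, .add (v := i * B) (by simp [BinOp.eval, *]) (by omega) <|
    .add (v := n - i * B) (by simp [BinOp.eval, *]) (by omega) <|
    .add (v := B - (n - i * B)) (by simp [BinOp.eval, *]) (by omega) <|
    .add (v := min B (n - i * B)) (by simp [BinOp.eval, Nat.sub_sub_eq_min, *]) (by omega) .nil,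
    by simp [h_n], ?_⟩
  constructor
  case zero =>
    intro y hy
    have : y ≠ 11 ∧ y ≠ 10 ∧ y ≠ 9 ∧ y ≠ 8 ∧ y ≠ 7 := by omega
    simp [this, h_zero y (by omega)]
  all_goals simp [*]

theorem SortRegs.computes_outputParams (h : SortRegs r e B off len (2 * n)) (h_n : r Reg.n = n)
    (hB : 2 * n + e * B < 2 ^ w) (hlen : n + len < 2 ^ w) (hoff : off < 2 ^ w) :
    ∃ r', Computes w outputParams r r' ∧
      MergeRegs r' (2 * n + e * B) n len (min off n + len) 0 0 := by
  obtain ⟨h_one, h_levels, h_blockSize, h_work, h_blockStart, h_blockLen, h_zero⟩ := h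
  refine ⟨_, .add (v := len) (by simp [BinOp.eval, *]) (by omega) <|
    .add (v := e * B) (by simp [BinOp.eval, *]) (by omega) <|
    .add (v := 2 * n + e * B) (by simp [BinOp.eval, h_work, add_comm]) hB <|
    .add (v := n) (by simp [BinOp.eval, *]) (by omega) <|
    .add (v := off - n) (by simp [BinOp.eval, *]) (by omega) <|
    .add (v := min off n) (by simp [BinOp.eval, Nat.sub_sub_eq_min, *]) (by omega) <|
    .add (v := min off n + len) (by simp [BinOp.eval, h_blockLen]) (by omega) .nil, ?_⟩
  constructor <;> simp [h_one, h_zero]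

/-- The keys when the first `t` elements of the input `L` have been merged into the output. -/
def Keys.output (L : List (Fin (2 ^ d))) (t : ℕ) : Keys d := fun y => (L ++ sortedSegment L 0 t)[y]?

theorem sortedRuns_of_le {α : Type*} [LinearOrder α] {X : List α} {W p : ℕ} (hX : X.length ≤ W)
    (hp : p < W) : sortedRuns W X p = (Multiset.sort (X : Multiset α))[p]? := by
  simpa [sortedSegment, List.take_of_length_le hX] using sortedRuns_mul_add X 0 hp

namespace Keys

theorem output_zero (L : List (Fin (2 ^ d))) : output L 0 = (L[·]?) := by
  funext y
  simp only [output, sortedSegment, List.take_zero, Multiset.coe_nil, Multiset.sort_zero,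
    List.append_nil]

theorem output_of_length_le (ht : L.length ≤ t) :
    output L t = ((L ++ Multiset.sort (L : Multiset _))[·]?) := by
  funext y
  simp only [output, sortedSegment, List.drop_zero, List.take_of_length_le ht]

theorem output_of_lt {y : ℕ} (hy : y < L.length) (t : ℕ) : output L t y = L[y]? :=
  List.getElem?_append_left hy

theorem output_add (L : List (Fin (2 ^ d))) (t y : ℕ) :
    output L t (L.length + y) = (sortedSegment L 0 t)[y]? := by
  rw [output, List.getElem?_append_right (Nat.le_add_right ..), Nat.add_sub_cancel_left]

theorem output_of_le {y : ℕ} (hy : 2 * L.length ≤ y) (t : ℕ) : output L t y = none :=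
  List.getElem?_eq_none (by rw [List.length_append, length_sortedSegment]; omega)

theorem output_write {t' : ℕ} (h : t ≤ t') :
    (output L t).write L.length (sortedSegment L 0 t') = output L t' := by
  funext y
  rcases lt_or_ge y L.length with hy | hy
  · rw [write, if_neg (by omega), output_of_lt hy, output_of_lt hy]
  obtain ⟨p, rfl⟩ := Nat.exists_eq_add_of_le hy
  rw [write, output_add, output_add, Nat.add_sub_cancel_left]
  split_ifs with hp
  · rfl
  rw [List.getElem?_eq_none (by rw [length_sortedSegment] at *; omega),
    List.getElem?_eq_none (by omega)]

theorem levels_write_of_le {a : ℕ} {l : List (Fin (2 ^ d))} (h : a + l.length ≤ base) (i : ℕ) :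
    (k.levels base B X i t).write a l = (k.write a l).levels base B X i t := by
  funext y
  simp only [write, levels]
  split_ifs <;> first | rfl | omega

theorem levels_output_write (L : List (Fin (2 ^ d))) (t B i : ℕ) :
    ((output L t).levels (2 * L.length) B X i 0).write L.length
        (sortedSegment L 0 t + sortedSegment L t B : Multiset (Fin (2 ^ d))).sort =
      (output L (t + B)).levels (2 * L.length) B X i 0 := by
  have sort_eq := sort_sortedSegment_add L 0 t B
  rw [zero_add] at sort_eq
  rw [sort_eq, levels_write_of_le (by rw [length_sortedSegment]; omega),
    output_write (Nat.le_add_right t B)]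

theorem mergeCells_output (hL : L.length ≤ 2 ^ e) (hkb : 2 * L.length + (e * B + B) ≤ kb) :
    MergeCells kb ((output L t).levels (2 * L.length) B ((L.drop t).take B) e 0)
      (2 * L.length + e * B) L.length (sortedSegment L 0 t) (sortedSegment L t B) := by
  constructor <;> simp only [length_sortedSegment]
  · intro p hp
    have length_le : ((L.drop t).take B).length ≤ 2 ^ e := by
      simpa using Or.inr (Nat.le_add_right_of_le hL)
    rw [levels_add_of_le (by omega) le_rfl, sortedRuns_of_le length_le (by omega), sortedSegment]
  · intro p hp
    rw [levels_of_lt (by omega), output_add]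
  all_goals omega

end Keys

theorem processBlock_exec (h : MainRegs r L.length e B) (he : 0 < e) (hB : 0 < B)
    (hL : L.length < 2 ^ e) (hi : i * B ≤ 2 * L.length)
    (hkb : 2 * L.length + (e + 1) * B ≤ kb) (hekb : 2 ^ e ≤ kb) :
    Exec w kb processBlock (update r Reg.block i) (.output L (i * B)) (update r Reg.block i)
      (.output L ((i + 1) * B)) (min ((i + 1) * B) L.length)
      (440 * (e * B) + 30 * L.length + 26) := by
  refine .of_valid fun ⟨_, hkw, _⟩ => ?_
  rw [Nat.succ_mul e] at hkb
  rw [Nat.succ_mul]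
  obtain ⟨r₁, h_block, h_n, h_sort⟩ :=
    h.computes_blockParams (w := w) (i := i) (by omega) (by omega) (by omega)
  generalize i * B = off at *
  obtain ⟨r₂, h_output, h_merge⟩ :=
    h_sort.computes_outputParams (w := w) h_n (by omega) (by omega) (by omega)
  set X := (L.drop off).take B with hX
  have hXl : X.length = min B (L.length - off) := by simp [hX]
  rw [← hXl] at h_sort h_merge
  have h_sorted (t : ℕ) : Exec w kb sortBlock r₁ (.output L t) r₁
      ((Keys.output L t).levels (2 * L.length) B X e 0) 0 (220 * (e * B)) :=
    sortBlock_exec h_sort he hB (by omega)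
      (fun p hp => by
        rw [Keys.output_of_lt (by omega), hX, List.getElem?_take_of_lt (by omega),
          List.getElem?_drop])
      (fun y hy => Keys.output_of_le hy t) (by omega) (by rwa [Nat.succ_mul e]) hekb
  have length_left : (sortedSegment L 0 off).length = min off L.length := by
    rw [length_sortedSegment, Nat.sub_zero]
  have length_right : (sortedSegment L off B).length = X.length := by
    rw [length_sortedSegment, hXl]
  rw [← length_left, ← length_right] at h_merge
  have h_out := mergeInto_exec (w := w) h_merge (Keys.mergeCells_output hL.le hkb)
    (pairwise_sortedSegment ..) (pairwise_sortedSegment ..)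
  rw [length_left, length_right, Keys.levels_output_write] at h_out
  refine (Exec.conj_ofList h_block (Exec.conj_self rfl (h_sorted off)
    (Exec.conj_ofList h_output h_out) (h_sorted (off + B)))).mono (by omega) ?_
  simp only [blockParams, outputParams, List.length_cons, List.length_nil]
  omega

theorem le_two_mul_sum_min (he : 0 < e) (hB : n ≤ e * B) :
    n * (e + 1) ≤ 2 * ∑ i ∈ Finset.range e, min ((i + 1) * B) n := by
  refine Nat.le_of_mul_le_mul_left ?_ he
  calc
    e * (n * (e + 1)) = 2 * ∑ i ∈ Finset.range e, n * (i + 1) := by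
      have := Finset.sum_range_id_mul_two (e + 1)
      rw [Finset.sum_range_succ', add_zero, Nat.add_sub_cancel] at this
      rw [← Finset.mul_sum]
      rw [mul_left_comm 2 n, mul_comm 2, this]
      ring
    _ ≤ 2 * ∑ i ∈ Finset.range e, e * min ((i + 1) * B) n := by
      refine Nat.mul_le_mul_left 2 (Finset.sum_le_sum fun i hi => ?_)
      rw [← Nat.mul_min_mul_left, le_min_iff]
      constructor
      · calc n * (i + 1) ≤ e * B * (i + 1) := Nat.mul_le_mul_right _ hB
          _ = e * ((i + 1) * B) := by ring
      · rw [mul_comm e]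
        exact Nat.mul_le_mul_left n (Finset.mem_range.1 hi)
    _ = e * (2 * ∑ i ∈ Finset.range e, min ((i + 1) * B) n) := by
      rw [← Finset.mul_sum]
      ring

theorem forLoop_processBlock_exec (h : MainRegs r L.length e B) (he : 0 < e) (hB : 0 < B)
    (hL : L.length < 2 ^ e) (hLe : L.length ≤ e * B) (heB : e * B ≤ 2 * L.length)
    (hkb : 2 * L.length + (e + 1) * B ≤ kb) (hekb : 2 ^ e ≤ kb) :
    Exec w kb (.forLoop Reg.block Reg.levels processBlock) r (L[·]?) r
      ((L ++ Multiset.sort (L : Multiset _))[·]?)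
      (∑ i ∈ Finset.range e, (min ((i + 1) * B) L.length + 1))
      (e * (440 * (e * B) + 30 * L.length + 29) + 3) := by
  have h_loop := Exec.forLoop_keys (w := w) (by decide) (fun i => Keys.output L (i * B))
    (fun i => min ((i + 1) * B) L.length) (h.zero _ le_rfl) h.levels fun i hi =>
      processBlock_exec h he hB hL ((Nat.mul_le_mul_right B hi.le).trans heB) hkb hekb
  simpa only [Nat.zero_mul, Keys.output_zero, Keys.output_of_length_le hLe] using h_loop

theorem sortProg_exec (hn : 2 ≤ L.length) (h_n : r Reg.n = L.length)
    (h_zero : ∀ y, 2 ≤ y → r y = 0) (hw : 8 * L.length < 2 ^ w) :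
    ∃ lo, L.length * (L.length.size + 1) ≤ 2 * lo ∧
      Exec w (8 * L.length) sortProg r (L[·]?) r ((L ++ Multiset.sort (L : Multiset _))[·]?) lo
        (1000 * (L.length.size * L.length)) := by
  obtain ⟨r₁, h_setup, h_regs⟩ := setup_exec (d := d) (w := w) (kb := 8 * L.length) h_n (by omega)
    h_zero (by omega)
  have two_pow_le : 2 ^ L.length.size ≤ 2 * L.length := two_pow_size_le (by omega)
  have he : 2 ≤ L.length.size := Nat.lt_size.2 (by simpa using hn)
  have heL : L.length.size ≤ L.length := Nat.size_le.2 L.length.lt_two_pow_self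
  have hL : L.length < 2 ^ L.length.size := L.length.lt_size_self
  generalize L.length.size = e at *
  set B := L.length / e + 1
  have le_mul : L.length ≤ e * B := (Nat.lt_mul_div_succ L.length (by omega)).le
  have mul_le : e * B ≤ L.length + e := by
    rw [Nat.mul_succ]
    exact Nat.add_le_add_right (Nat.mul_div_le L.length e) e
  have hB : B ≤ L.length + 1 := Nat.succ_le_succ (Nat.div_le_self L.length e)
  have h_blocks := forLoop_processBlock_exec (w := w) (kb := 8 * L.length) h_regs (by omega)
    (Nat.succ_pos _) hL le_mul (by omega) (by rw [Nat.succ_mul e]; omega)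
    (by omega)
  refine ⟨_, (le_two_mul_sum_min (by omega) le_mul).trans (Nat.mul_le_mul_left 2
    (Finset.sum_le_sum fun i _ => Nat.le_succ _)),
    (Exec.conj_self rfl (h_setup _) h_blocks (h_setup _)).mono le_rfl ?_⟩
  have body_le : e * (440 * (e * B) + 30 * L.length + 29) ≤ e * (930 * L.length) :=
    Nat.mul_le_mul_left e (by omega)
  have e_le : e * 2 ≤ e * L.length := Nat.mul_le_mul_left e hn
  rw [Nat.mul_left_comm e 930] at body_le
  omega

end SortProg

/-! ### Time and space -/

section Resources

variable {n : ℕ} {c : Cost}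

theorem logb_two_le_size (n : ℕ) : Real.logb 2 n ≤ n.size := by
  rcases n.eq_zero_or_pos with rfl | hn
  · simp
  rw [Real.logb_le_iff_le_rpow one_lt_two (Nat.cast_pos.2 hn), Real.rpow_natCast]
  exact_mod_cast n.lt_size_self.le

theorem size_le_two_mul_logb_two (hn : 2 ≤ n) : (n.size : ℝ) ≤ 2 * Real.logb 2 n := by
  have le_logb {m : ℕ} (hm : 2 ^ m ≤ n) : (m : ℝ) ≤ Real.logb 2 n := by
    rw [Real.le_logb_iff_rpow_le one_lt_two (by positivity), Real.rpow_natCast]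
    exact_mod_cast hm
  obtain ⟨m, hm⟩ := Nat.exists_eq_succ_of_ne_zero (Nat.size_pos.2 (pos_of_gt hn)).ne'
  have h_one := le_logb (m := 1) (by simpa using hn)
  have h_m := le_logb (Nat.lt_size.1 (hm ▸ m.lt_succ_self))
  rw [hm]
  push_cast at h_one ⊢
  linarith

theorem length_append_le_keys {L S : List (Fin (2 ^ d))} (hS : S ≠ [])
    (h : P.Run w (.ofKeys n d L) (.ofKeys n d (L ++ S)) c) : (L ++ S).length ≤ c.keys := by
  by_contra! h_lt
  have hS := List.length_pos_iff.2 hS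
  rw [List.length_append] at h_lt
  have h_last : (L ++ S)[L.length + S.length - 1]? = L[L.length + S.length - 1]? :=
    h.key_eq (by omega)
  rw [List.getElem?_eq_none (l := L) (by omega), List.getElem?_eq_none_iff,
    List.length_append] at h_last
  omega

theorem le_auxSpace (h : 2 * n ≤ c.keys) : n * d ≤ auxSpace P n d w c := by
  have : n * d ≤ (c.keys - n) * d := Nat.mul_le_mul_right d (by omega)
  unfold auxSpace
  omega

theorem auxSpace_le {K a : ℕ} (h_bits : c.bits = 0) (h_keys : c.keys ≤ a * n)
    (hw : w ≤ K * (n * d)) : auxSpace P n d w c ≤ (a + P.regs.card * K) * (n * d) :=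
  calc
    auxSpace P n d w c ≤ a * n * d + P.regs.card * (K * (n * d)) := by
      rw [auxSpace, h_bits, zero_add]
      gcongr
      exact (Nat.sub_le ..).trans h_keys
    _ = (a + P.regs.card * K) * (n * d) := by ring

theorem sortProg_run {L : List (Fin (2 ^ d))} (hL : 2 ≤ L.length) (hd : d < 2 ^ w)
    (hw : 8 * L.length < 2 ^ w) :
    ∃ c, sortProg.Run w (.ofKeys L.length d L)
        (.ofKeys L.length d (L ++ Multiset.sort (L : Multiset _))) c ∧
      c.energy = 0 ∧ c.bits = 0 ∧ c.keys ≤ 8 * L.length ∧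
      L.length * (L.length.size + 1) ≤ 2 * c.time ∧
      c.time ≤ 1000 * (L.length.size * L.length) := by
  obtain ⟨lo, h_lo, h_exec⟩ := sortProg_exec (w := w) (L := L)
    (r := (State.ofKeys L.length d L).reg) hL rfl
    (fun y hy => by simp [State.ofKeys, show y ≠ 0 ∧ y ≠ 1 by omega]) hw
  have one_le : 1 ≤ w := Nat.one_le_iff_ne_zero.2 (by rintro rfl; omega)
  have h_fits : Fits w (State.ofKeys L.length d L).reg := fun x => by
    simp only [State.ofKeys]
    split_ifs <;> omega
  obtain ⟨c, h_run, h_energy, h_bits, h_keys, h_le, h_ge⟩ := h_exec ⟨one_le, hw, h_fits⟩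
  exact ⟨c, h_run, h_energy, h_bits, h_keys, h_lo.trans (Nat.mul_le_mul_left 2 h_le), h_ge⟩

end Resources

end EnergyRAM

open EnergyRAM in
theorem mainTheorem2_general :
    ∃ (P : Prog) (a : ℕ) (c₁ c₂ c₃ : ℝ), 0 < c₁ ∧ 0 < c₂ ∧ 0 < c₃ ∧
      ∀ K : ℕ, ∃ c₄ : ℝ, 0 < c₄ ∧
        ∀ n d w : ℕ, 2 ≤ n → 1 ≤ d → a * (n * d) < 2 ^ w → w ≤ K * (n * d) →
          ∀ L : List (Fin (2 ^ d)), L.length = n →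
            ∃ (S : List (Fin (2 ^ d))) (c : Cost),
              S.Perm L ∧ S.Pairwise (· ≤ ·) ∧
              P.Run w (State.ofKeys n d L) (State.ofKeys n d (L ++ S)) c ∧
              c₁ * (n * Real.logb 2 n) ≤ c.time ∧ (c.time : ℝ) ≤ c₂ * (n * Real.logb 2 n) ∧
              c₃ * (n * d) ≤ auxSpace P n d w c ∧ (auxSpace P n d w c : ℝ) ≤ c₄ * (n * d) ∧
              c.energy = 0 := by
  refine ⟨sortProg, 8, 1 / 2, 2000, 1, by norm_num, by norm_num, by norm_num, fun K =>
    ⟨8 + sortProg.regs.card * K, by positivity, ?_⟩⟩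
  rintro n d w hn hd haw hwK L rfl
  have length_le : L.length ≤ L.length * d := Nat.le_mul_of_pos_right _ hd
  have d_le : d ≤ L.length * d := Nat.le_mul_of_pos_left _ (by omega)
  obtain ⟨c, h_run, h_energy, h_bits, h_keys, h_ge, h_le⟩ :=
    sortProg_run (w := w) (L := L) hn (by omega) (by omega)
  set S := Multiset.sort (L : Multiset (Fin (2 ^ d))) with hS
  have S_perm : S.Perm L := by rw [← Multiset.coe_eq_coe, hS, Multiset.sort_eq]
  have S_ne : S ≠ [] := List.ne_nil_of_length_pos (by rw [S_perm.length_eq]; omega)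
  have keys_ge : 2 * L.length ≤ c.keys := by
    simpa [S_perm.length_eq, two_mul] using length_append_le_keys S_ne h_run
  have h_mul_logb := mul_le_mul_of_nonneg_left (logb_two_le_size L.length) L.length.cast_nonneg
  have h_mul_size := mul_le_mul_of_nonneg_left (size_le_two_mul_logb_two hn) L.length.cast_nonneg
  refine ⟨S, c, S_perm, Multiset.pairwise_sort _ _, h_run, ?_, ?_, ?_, ?_, h_energy⟩
  · rify at h_ge
    linarith
  · rify at h_le
    linarith
  · rw [one_mul]
    exact_mod_cast le_auxSpace keys_ge
  · exact_mod_cast auxSpace_le h_bits h_keys hwK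

open EnergyRAM in
theorem mainTheorem2 :
    ∃ (P : Prog) (a : ℕ) (c₁ c₂ c₃ : ℝ), 0 < c₁ ∧ 0 < c₂ ∧ 0 < c₃ ∧
      ∀ K : ℕ, ∃ c₄ : ℝ, 0 < c₄ ∧
        ∀ n d w : ℕ, 2 ≤ n → 1 ≤ d → d ≤ w → a * (n * d) < 2 ^ w → w ≤ K * (n * d) →
          ∀ L : List (Fin (2 ^ d)), L.length = n →
            ∃ (S : List (Fin (2 ^ d))) (c : Cost),
              S.Perm L ∧ S.Pairwise (· ≤ ·) ∧
              P.Run w (State.ofKeys n d L) (State.ofKeys n d (L ++ S)) c ∧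
              c₁ * (n * Real.logb 2 n) ≤ c.time ∧ (c.time : ℝ) ≤ c₂ * (n * Real.logb 2 n) ∧
              c₃ * (n * d) ≤ auxSpace P n d w c ∧ (auxSpace P n d w c : ℝ) ≤ c₄ * (n * d) ∧
              c.energy = 0 := by
  obtain ⟨P, a, c₁, c₂, c₃, h₁, h₂, h₃, h⟩ := mainTheorem2_general
  exact ⟨P, a, c₁, c₂, c₃, h₁, h₂, h₃, fun K => (h K).imp fun _ ⟨h₄, h⟩ =>
    ⟨h₄, fun n d w hn hd _ => h n d w hn hd⟩⟩
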